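/- For every $n\ge 3$ and $f\in\{0,\dots,\binom n2\}$ consider streams of edge insertions and edge deletions over the vertex set $V=\{1,\dots,n\}$, starting from the empty graph, in which only absent edges are inserted, only present edges are deleted, and at most $f$ deletions occur. Insertions and deletions may be interleaved in any order. For such a stream $\sigma$ let $G_\sigma$ be the simple graph present at its end; if no edge is inserted twice, $G_\sigma=G-F$, where $G$ is the graph of all inserted edges and $F\subseteq G$ the set of deleted edges. A graph $H$ on $V$ is a $t$-spanner of a graph $G'$ on $V$ if $H\subseteq G'$ and $\mathrm{dist}_H(u,v)\le t\cdot \mathrm{dist}_{G'}(u,v)$ for all $u,v\in V$ (distances may be $\infty$). A randomized streaming algorithm with $s$ bits of space (for given $n$ and $f$) reads the stream once and keeps between consecutive stream items nothing but a memory content in $\{0,1\}^s$: the initial content is random, each stream item replaces the content by a random new one, whose law depends only on the old content and the item, and at the end a graph on $V$ is computed from the content. (The computation within a step is not bounded; random bits that are reused later count towards the space.) **Theorem.** There are constants $C_1,C_2>0$ and $k\in\mathbb N$ and, for all $n$ and $f$ as above, a randomized streaming algorithm $A_{n,f}$ with at most $$C_1\, n^{4/3}\max\{f,1\}^{1/3}\,(\log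 n)^k=\widetilde O\!\left(n^{4/3}\max\{f,1\}^{1/3}\right)$$ bits of space such that for every stream $\sigma$ as above (fixed independently of the randomness of the algorithm, i.e. oblivious), with probability at least $1-n^{-100}$ over the internal randomness, $A_{n,f}$ on $\sigma$ outputs a $t$-spanner of $G_\sigma$, where $t=C_2\log n\,\log\log n$. -/

import Mathlib

/-- One item of a dynamic edge stream over the vertex set `Fin n`: an unordered pair of vertices
is either inserted into or deleted from the current graph. -/
inductive EdgeUpdate (n : ℕ) : Type where
  | insert (e : Sym2 (Fin n)) : EdgeUpdate n
  | delete (e : Sym2 (Fin n)) : EdgeUpdate n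

namespace EdgeUpdate

variable {n : ℕ}

/-- The effect of one update on the current edge set. -/
def apply (E : Finset (Sym2 (Fin n))) : EdgeUpdate n → Finset (Sym2 (Fin n))
  | insert e => Insert.insert e E
  | delete e => E.erase e

/-- An update is legal for the current edge set `E` if it inserts an absent non-loop edge or
deletes a present edge. -/
def IsLegal (E : Finset (Sym2 (Fin n))) : EdgeUpdate n → Prop
  | insert e => ¬ e.IsDiag ∧ e ∉ E
  | delete e => e ∈ E

/-- Whether an update is a deletion. -/
def isDeletion : EdgeUpdate n → Bool
  | insert _ => false
  | delete _ => true

end EdgeUpdate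

/-- All updates of the stream are legal when they are applied in order, starting from `E`. -/
def IsValidStreamFrom {n : ℕ} : Finset (Sym2 (Fin n)) → List (EdgeUpdate n) → Prop
  | _, [] => True
  | E, u :: σ => u.IsLegal E ∧ IsValidStreamFrom (u.apply E) σ

/-- A valid stream of insertions and deletions, starting from the empty graph. -/
def IsValidStream {n : ℕ} (σ : List (EdgeUpdate n)) : Prop :=
  IsValidStreamFrom ∅ σ

/-- The number of deletions in a stream. -/
def numDeletions {n : ℕ} (σ : List (EdgeUpdate n)) : ℕ :=
  σ.countP EdgeUpdate.isDeletion

/-- The graph that results from a stream: the inserted edges minus the deleted ones. -/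
def streamGraph {n : ℕ} (σ : List (EdgeUpdate n)) : SimpleGraph (Fin n) :=
  SimpleGraph.fromEdgeSet (σ.foldl EdgeUpdate.apply ∅ : Finset (Sym2 (Fin n)))

/-- `H` is a `t`-spanner of `G`: a subgraph of `G` (on the same vertices) in which every distance
is at most `t` times the distance in `G`. Distances are extended (`∞` between different
components). -/
def IsSpanner {V : Type*} (t : ℝ) (G H : SimpleGraph V) : Prop :=
  H ≤ G ∧ ∀ u v : V, (H.edist u v : ENNReal) ≤ ENNReal.ofReal t * (G.edist u v : ENNReal)

/-- A randomized one-pass streaming algorithm on `n`-vertex edge streams with `s` bits of memory.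
The memory content is all that survives from one stream item to the next; in particular the
algorithm has fresh random coins in every step, but no access to the coins of earlier steps except
through what it has stored in its `s` bits. At the end of the stream, a graph is read off from the
memory content. -/
structure StreamingAlgorithm (n s : ℕ) where
  /-- the random initial memory content -/
  init : PMF (Fin s → Bool)
  /-- the random new memory content after reading one stream item -/
  step : (Fin s → Bool) → EdgeUpdate n → PMF (Fin s → Bool)
  /-- the graph that is returned at the end of the stream -/
  output : (Fin s → Bool) → SimpleGraph (Fin n)

namespace StreamingAlgorithm

variable {n s : ℕ}

/-- The law of the memory content after reading a stream, starting from memory content `m`. -/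
noncomputable def runFrom (A : StreamingAlgorithm n s) :
    (Fin s → Bool) → List (EdgeUpdate n) → PMF (Fin s → Bool)
  | m, [] => PMF.pure m
  | m, u :: σ => (A.step m u).bind fun m' => A.runFrom m' σ

/-- The law of the graph that the algorithm returns on the stream `σ`. -/
noncomputable def outputLaw (A : StreamingAlgorithm n s) (σ : List (EdgeUpdate n)) :
    PMF (SimpleGraph (Fin n)) :=
  (A.init.bind fun m => A.runFrom m σ).map A.output

end StreamingAlgorithm

/-!
Write `scale n ≈ log₂ n`. Everything rests on the sets that `IsDense D E` singles out: vertex sets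
`W` which span at least `D |W| (1 + log |W|)` edges of `E`. An edge set without dense sets has
`O (D n log n)` edges and can be stored explicitly (`card_le_of_not_isDense`). A minimal dense set
expands: a small part `S` of it has at least `D |S| log (|W| / |S|)` edges to the rest, because
otherwise one of the two sides would be dense (`IsMinDense.le_card_cut`), and this survives the
deletion of a set `F` of edges on the `light` vertices, those that lose fewer than `D / 8` edges,
provided that at most `D / 8` vertices are not light (`IsMinDense.le_card_cut_light`). Together with
the sparsity of small parts, expansion makes balls grow: if `m` is the number of edges in a ball and
`y` is `m` divided by `D log n`, up to a constant, then `log (|W| / y)` shrinks by a factor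
`1 - Ω (1 / log n)` with each step, so that `O (log n log log n)` steps reach more than half of the
vertices (`growth_steps_le`, `edist_le_of_expanding`). The stretch in the theorem is this diameter.

*Few deletions* (`f² < n`). With `D = 16 (f + 1)`, no vertex is ever damaged. The algorithm is
deterministic: it stores every inserted edge unless that edge completes a dense set of stored edges.
Both ends of a dropped edge lie in a minimal dense set which has lost at most `f + 1` edges since,
hence they stay close (`sparseEdges_spec`, `exists_algorithm_few_deletions`).

*Many deletions* (`n ≤ f²`). Here `D` is about `(n f) ^ (1 / 3) log n`. Inserted edges are buffered.
When the buffer has a dense set, a minimal one becomes a *cluster*, and its edges leave the buffer.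
Since a cluster of size `w` uses up `D w` edges, the sizes of all clusters add up to at most
`n² / D`. An edge inside a cluster is handled as follows.

* The edges that formed the cluster are sampled with probability `D⁻¹` up to logarithmic factors and
  the sample is stored, as is the list of all deleted edges. The sample still expands on the light
  vertices, simultaneously for all small `S` (`prob_not_goodExpansion_le`); the stream is oblivious,
  so the sample is independent of it. Hence light vertices are close to each other.
* At most `16 f / D` vertices of a cluster are not light (`card_sdiff_light_mul_le`). For each vertex
  of a cluster, linear sketches of the edges of the cluster at that vertex are kept, for random
  samples of all densities. They are power sums over a prime field, and determine every set of at
  most `s`, about `2 (16 f / D) + O (log n)`, edges (`eq_of_powerSum_eq`). So either all edges at the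
  vertex are recovered, or more than half of them lead to light vertices and one of those is found
  (`prob_not_goodLevel_le`).

Consequently both ends of the edge are light or adjacent to light vertices in the output
(`isSpanner_outEdges`). The sketches occupy `(n² / D) (f / D)` numbers, the buffer `D n log n` edges
and the stored sample `n² / D` edges; all of these balance at `n (n f) ^ (1 / 3)` up to logarithmic
factors (`manySpace_le`).

An algorithm with `s` bits cannot remember its coins for free. All random choices are functions of
one random labelling of the pairs of vertices, and a polynomial number of labellings does as well as
all of them, against every fixed stream (`exists_seeds`); the index of one of them is stored. A code
of the stream that can be updated item by item, together with such a seed, is a streaming algorithm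
(`exists_streamingAlgorithm`).
-/

namespace DynamicSpanner

open Finset

/-! ### Dense vertex sets and their expansion -/

section Dense

variable {V : Type*} [DecidableEq V]

/-- The edges of `E` with both endpoints in `S`. -/
def inner (E : Finset (Sym2 V)) (S : Finset V) : Finset (Sym2 V) :=
  E ∩ S.sym2

/-- The edges of `E` with one endpoint in `S` and the other one in `T`. -/
def cut (E : Finset (Sym2 V)) (S T : Finset V) : Finset (Sym2 V) :=
  E ∩ (S ×ˢ T).image fun p => s(p.1, p.2)

/-- The edges of `E` at the vertex `v`. -/
def star (E : Finset (Sym2 V)) (v : V) : Finset (Sym2 V) :=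
  E.filter fun e => v ∈ e

/-- `W` spans at least `D |W| (1 + log |W|)` edges of `E`. The slowly growing factor is what forces
minimal dense sets to expand. -/
def IsDense (D : ℕ) (E : Finset (Sym2 V)) (W : Finset V) : Prop :=
  W.Nonempty ∧ (D : ℝ) * #W * (1 + Real.log #W) ≤ #(inner E W)

/-- A dense set none of whose proper subsets is dense. -/
def IsMinDense (D : ℕ) (E : Finset (Sym2 V)) (W : Finset V) : Prop :=
  Minimal (IsDense D E) W

lemma mem_inner {E : Finset (Sym2 V)} {S : Finset V} {e : Sym2 V} :
    e ∈ inner E S ↔ e ∈ E ∧ ∀ v ∈ e, v ∈ S := by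
  simp [inner, mem_sym2_iff]

lemma mem_cut {E : Finset (Sym2 V)} {S T : Finset V} {e : Sym2 V} :
    e ∈ cut E S T ↔ e ∈ E ∧ ∃ u ∈ S, ∃ v ∈ T, s(u, v) = e := by
  simp only [cut, mem_inter, mem_image, mem_product, Prod.exists, and_congr_right_iff]
  intro _
  constructor
  · rintro ⟨a, b, ⟨ha, hb⟩, h⟩
    exact ⟨a, ha, b, hb, h⟩
  · rintro ⟨a, ha, b, hb, h⟩
    exact ⟨a, b, ⟨ha, hb⟩, h⟩

lemma mem_star {E : Finset (Sym2 V)} {v : V} {e : Sym2 V} : e ∈ star E v ↔ e ∈ E ∧ v ∈ e := by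
  simp [star]

lemma inner_mono {E E' : Finset (Sym2 V)} (h : E ⊆ E') (S : Finset V) :
    inner E S ⊆ inner E' S :=
  inter_subset_inter_right h

lemma IsDense.mono {D : ℕ} {E E' : Finset (Sym2 V)} {W : Finset V} (h : IsDense D E W)
    (hE : E ⊆ E') : IsDense D E' W :=
  ⟨h.1, h.2.trans (by exact_mod_cast card_le_card (inner_mono hE W))⟩

lemma IsDense.exists_minDense {D : ℕ} {E : Finset (Sym2 V)} {W : Finset V} (h : IsDense D E W) :
    ∃ W', IsMinDense D E W' := by
  obtain ⟨W', _, hW'⟩ := exists_minimal_le_of_wellFoundedLT (IsDense D E) W h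
  exact ⟨W', hW'⟩

/-- The property only depends on the edges inside `W`. -/
lemma IsMinDense.restrict {D : ℕ} {E : Finset (Sym2 V)} {W : Finset V} (h : IsMinDense D E W) :
    IsMinDense D (inner E W) W := by
  have key : ∀ S, S ⊆ W → inner (inner E W) S =
      inner E S := by
    intro S hS
    ext e
    simp only [mem_inner]
    exact ⟨fun h => ⟨h.1.1, h.2⟩, fun h => ⟨⟨h.1, fun v hv => hS (h.2 v hv)⟩, h.2⟩⟩
  refine ⟨⟨h.prop.1, ?_⟩, fun S hS hSW => h.2 ⟨hS.1, ?_⟩ hSW⟩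
  · rw [key W subset_rfl]
    exact h.prop.2
  · rw [← key S hSW]
    exact hS.2

lemma card_inner_le_add_cut (E : Finset (Sym2 V)) (S W : Finset V) :
    #(inner E W) ≤ #(inner E S) + #(inner E (W \ S)) + #(cut E S (W \ S)) := by
  have : inner E W ⊆ inner E S ∪ inner E (W \ S) ∪ cut E S (W \ S) := by
    intro e he
    induction e using Sym2.ind with
    | _ u v =>
      simp only [mem_union, mem_inner, mem_cut, Sym2.mem_iff, forall_eq_or_imp, forall_eq,
        mem_sdiff] at he ⊢
      obtain ⟨hE, hu, hv⟩ := he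
      by_cases h1 : u ∈ S <;> by_cases h2 : v ∈ S
      · exact Or.inl (Or.inl ⟨hE, h1, h2⟩)
      · exact Or.inr ⟨hE, u, h1, v, ⟨hv, h2⟩, rfl⟩
      · exact Or.inr ⟨hE, v, h2, u, ⟨hu, h1⟩, Sym2.eq_swap⟩
      · exact Or.inl (Or.inr ⟨hE, ⟨hu, h1⟩, hv, h2⟩)
  refine (card_le_card this).trans ((card_union_le _ _).trans ?_)
  exact Nat.add_le_add_right (card_union_le _ _) _

/-- In terms of balls: the edges in the ball `S` and those that leave it all lie in the next ball
`U`. -/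
lemma card_inner_add_cut_le (X : Finset (Sym2 V)) {S T U : Finset V} (hST : Disjoint S T)
    (hU : ∀ u ∈ S, ∀ v ∈ T, s(u, v) ∈ X → v ∈ U) (hSU : S ⊆ U) :
    #(inner X S) + #(cut X S T) ≤ #(inner X U) := by
  rw [← card_union_of_disjoint]
  · refine card_le_card fun e he => ?_
    rcases mem_union.1 he with he | he
    · rw [mem_inner] at he ⊢
      exact ⟨he.1, fun v hv => hSU (he.2 v hv)⟩
    · obtain ⟨hX, u, hu, v, hv, rfl⟩ := mem_cut.1 he
      rw [mem_inner]
      refine ⟨hX, fun w hw => ?_⟩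
      rcases Sym2.mem_iff.1 hw with rfl | rfl
      · exact hSU hu
      · exact hU u hu _ hv hX
  · rw [disjoint_left]
    intro e he he'
    obtain ⟨_, u, hu, v, hv, rfl⟩ := mem_cut.1 he'
    exact disjoint_left.1 hST ((mem_inner.1 he).2 v (Sym2.mem_mk_right u v)) hv

lemma IsMinDense.card_inner_le {D : ℕ} {E : Finset (Sym2 V)} {W S : Finset V}
    (h : IsMinDense D E W) (hS : S.Nonempty) (hSW : S ⊂ W) :
    (#(inner E S) : ℝ) ≤ D * #S * (1 + Real.log #S) := by
  by_contra hc
  exact hSW.2 (h.2 ⟨hS, (not_le.1 hc).le⟩ hSW.1)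

/-- Minimal dense sets expand: both sides of the cut are too sparse to account for all edges. -/
lemma IsMinDense.le_card_cut {D : ℕ} {E : Finset (Sym2 V)} {W S : Finset V}
    (h : IsMinDense D E W) (hS : S.Nonempty) (hSW : S ⊆ W) (hcard : 2 * #S ≤ #W) :
    (D : ℝ) * #S * Real.log (#W / #S) ≤ #(cut E S (W \ S)) := by
  have hSpos : 0 < #S := hS.card_pos
  have hT : #(W \ S) = #W - #S := card_sdiff_of_subset hSW
  have hTpos : 0 < #(W \ S) := by omega
  have hss : S ⊂ W := by
    refine ⟨hSW, fun hc => ?_⟩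
    have := card_le_card hc
    omega
  have hts : W \ S ⊂ W := sdiff_ssubset hSW hS
  have h1 := h.card_inner_le hS hss
  have h2 := h.card_inner_le (card_pos.1 hTpos) hts
  have h3 := h.prop.2
  have h4 : (#(inner E W) : ℝ) ≤ #(inner E S) + #(inner E (W \ S)) + #(cut E S (W \ S)) := by
    exact_mod_cast card_inner_le_add_cut E S W
  have h5 : (#(W \ S) : ℝ) = #W - #S := by
    rw [hT, Nat.cast_sub (by omega)]
  have hSpos' : (0 : ℝ) < #S := by exact_mod_cast hSpos
  have hTpos' : (0 : ℝ) < #(W \ S) := by exact_mod_cast hTpos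
  have hlog : Real.log (#W / #S) = Real.log #W - Real.log #S :=
    Real.log_div (by linarith) hSpos'.ne'
  have hmono : Real.log #(W \ S) ≤ Real.log #W :=
    Real.log_le_log hTpos' (by linarith)
  have h6 : (0 : ℝ) ≤ D * #(W \ S) * (Real.log #W - Real.log #(W \ S)) :=
    mul_nonneg (by positivity) (by linarith)
  rw [hlog]
  have h7 : (#W : ℝ) = #S + #(W \ S) := by linarith
  have : (D : ℝ) * #W * (1 + Real.log #W) =
      D * #S * (1 + Real.log #W) + D * #(W \ S) * (1 + Real.log #W) := by
    rw [← add_mul, ← mul_add, ← h7]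
  nlinarith

/-- The vertices of `W` that lose fewer than `D / 8` edges to the edge set `F`. -/
def light (D : ℕ) (F : Finset (Sym2 V)) (W : Finset V) : Finset V :=
  W.filter fun v => 8 * #(star F v) < D

lemma light_subset (D : ℕ) (F : Finset (Sym2 V)) (W : Finset V) : light D F W ⊆ W :=
  filter_subset _ _

/-- Each edge of `F` damages at most two vertices. -/
lemma card_sdiff_light_mul_le (D : ℕ) (F : Finset (Sym2 V)) (W : Finset V) :
    #(W \ light D F W) * D ≤ 16 * #F := by
  have h1 : ∑ v ∈ W \ light D F W, #(star F v) ≤ 2 * #F := by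
    have := sum_card_bipartiteAbove_eq_sum_card_bipartiteBelow (fun (v : V) (e : Sym2 V) => v ∈ e)
      (s := W \ light D F W) (t := F)
    change ∑ v ∈ W \ light D F W, #(bipartiteAbove (fun (v : V) (e : Sym2 V) => v ∈ e) F v) ≤ _
    rw [this]
    refine (sum_le_card_nsmul _ _ 2 fun e _ => ?_).trans (by rw [smul_eq_mul, mul_comm])
    induction e using Sym2.ind with
    | _ u v =>
      refine (card_le_card (t := {u, v}) fun x hx => ?_).trans card_le_two
      simpa [bipartiteBelow] using (mem_filter.1 hx).2
  have h2 : #(W \ light D F W) * D ≤ ∑ v ∈ W \ light D F W, 8 * #(star F v) := by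
    rw [← smul_eq_mul]
    refine card_nsmul_le_sum _ _ _ fun v hv => ?_
    simp only [light, mem_sdiff, mem_filter, not_and, not_lt] at hv
    exact hv.2 hv.1
  rw [← mul_sum] at h2
  omega

/-- The expansion of a minimal dense set survives the deletion of `F` on its lightly damaged
vertices, as long as there are few other ones. -/
lemma IsMinDense.le_card_cut_light {D : ℕ} {E F : Finset (Sym2 V)} {W S : Finset V}
    (h : IsMinDense D E W) (hheavy : 8 * #(W \ light D F W) ≤ D) (hS : S.Nonempty)
    (hSL : S ⊆ light D F W) (hcard : 2 * #S ≤ #W) :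
    (D : ℝ) * #S * Real.log (#W / #S) / 2 ≤ #(cut (E \ F) S (light D F W \ S)) := by
  set L := light D F W with hL
  have hLW : L ⊆ W := light_subset D F W
  have hcut := h.le_card_cut hS (hSL.trans hLW) hcard
  have hsub : cut E S (W \ S) ⊆ cut (E \ F) S (L \ S) ∪
      (S.biUnion (fun v => star F v) ∪ (S ×ˢ (W \ L)).image fun p => s(p.1, p.2)) := by
    intro e he
    obtain ⟨hE, u, hu, v, hv, rfl⟩ := mem_cut.1 he
    rw [mem_sdiff] at hv
    simp only [mem_union, mem_biUnion, mem_star, mem_cut, mem_image, mem_product, mem_sdiff]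
    by_cases hF : s(u, v) ∈ F
    · exact Or.inr (Or.inl ⟨u, hu, hF, Sym2.mem_mk_left u v⟩)
    · by_cases hvL : v ∈ L
      · exact Or.inl ⟨⟨hE, hF⟩, u, hu, v, ⟨hvL, hv.2⟩, rfl⟩
      · exact Or.inr (Or.inr ⟨(u, v), ⟨hu, hv.1, hvL⟩, rfl⟩)
  have h1 : 8 * #(S.biUnion fun v => star F v) ≤ #S * D := by
    have : #(S.biUnion fun v => star F v) ≤ ∑ v ∈ S, #(star F v) := card_biUnion_le
    have h' : ∑ v ∈ S, 8 * #(star F v) ≤ #S * D := by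
      rw [← smul_eq_mul (#S)]
      refine sum_le_card_nsmul _ _ _ fun v hv => ?_
      exact (mem_filter.1 (hSL hv)).2.le
    rw [← mul_sum] at h'
    omega
  have h2 : 8 * #((S ×ˢ (W \ L)).image fun p => s(p.1, p.2)) ≤ #S * D := by
    have : #((S ×ˢ (W \ L)).image fun p => s(p.1, p.2)) ≤ #S * #(W \ L) :=
      card_image_le.trans (card_product _ _).le
    nlinarith
  have h3 : #(cut E S (W \ S)) ≤ #(cut (E \ F) S (L \ S)) +
      (#(S.biUnion fun v => star F v) + #((S ×ˢ (W \ L)).image fun p => s(p.1, p.2))) :=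
    (card_le_card hsub).trans ((card_union_le _ _).trans
      (Nat.add_le_add_left (card_union_le _ _) _))
  have h4 : 8 * #(cut E S (W \ S)) ≤ 8 * #(cut (E \ F) S (L \ S)) + 2 * (#S * D) := by omega
  have h4' : (8 : ℝ) * #(cut E S (W \ S)) ≤ 8 * #(cut (E \ F) S (L \ S)) + 2 * (#S * D) := by
    exact_mod_cast h4
  have hSpos : (0 : ℝ) < #S := by exact_mod_cast hS.card_pos
  have hlog : (1 : ℝ) / 2 ≤ Real.log (#W / #S) := by
    have h2le : (2 : ℝ) ≤ #W / #S := by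
      rw [le_div_iff₀ hSpos]
      exact_mod_cast hcard
    have := Real.log_le_log (by norm_num) h2le
    have := Real.log_two_gt_d9
    linarith
  have h5 : (D : ℝ) * #S * (1 / 2) ≤ D * #S * Real.log (#W / #S) :=
    mul_le_mul_of_nonneg_left hlog (by positivity)
  linarith

end Dense

/-! ### Growth of balls in an expanding edge set -/

lemma half_mul_log_div_le {N a y : ℝ} (hy : 0 < y) (hya : y ≤ a) (haN : 2 * a ≤ N) :
    y * Real.log (N / y) / 2 ≤ a * Real.log (N / a) := by
  have ha : 0 < a := hy.trans_le hya
  have hN : 0 < N := by linarith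
  have h1 : Real.log (N / y) = Real.log (N / a) + Real.log (a / y) := by
    rw [← Real.log_mul (by positivity) (by positivity)]
    congr 1
    field_simp
  have h2 : Real.log (a / y) ≤ a / y - 1 := Real.log_le_sub_one_of_pos (by positivity)
  have h3 : 1 / 2 ≤ Real.log (N / a) := by
    have h2le : (2 : ℝ) ≤ N / a := by rwa [le_div_iff₀ ha]
    have := Real.log_le_log (by norm_num) h2le
    have := Real.log_two_gt_d9
    linarith
  have h4 : y * Real.log (a / y) ≤ a - y := by
    have := mul_le_mul_of_nonneg_left h2 hy.le
    rw [mul_sub, mul_div_cancel₀ _ hy.ne', mul_one] at this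
    exact this
  rw [h1]
  nlinarith

/-- Think of `a r` as the number of vertices and of `m r` as the number of edges of a ball of
radius `r`. With `Λ = 1 + log N` and `y = m / (32 κ Λ) ≤ a`, the quantity `log (N / y)` shrinks by
the factor `1 - 1 / (128 Λ)` in each step. It starts below `5 Λ` and cannot fall below `log 2`, so
there are only `O (Λ log Λ)` steps. -/
lemma growth_steps_le {N κ : ℝ} (hN : 2 ≤ N) (hκ : 0 < κ) {m a : ℕ → ℝ} {R : ℕ}
    (ha1 : ∀ r ≤ R, 1 ≤ a r) (haN : ∀ r ≤ R, 2 * a r ≤ N) (ha0 : a 0 = 1) (hm0 : 0 ≤ m 0)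
    (hm : ∀ r ≤ R, m r ≤ 32 * κ * a r * (1 + Real.log (a r)))
    (hstep : ∀ r < R, m r + κ * a r * Real.log (N / a r) ≤ m (r + 1)) :
    (R : ℝ) ≤ 128 * (1 + Real.log N) * Real.log (8 * (1 + Real.log N)) + 1 := by
  set Λ := 1 + Real.log N with hΛ
  have hlog2 := Real.log_two_gt_d9
  have hlogN : Real.log 2 ≤ Real.log N := Real.log_le_log (by norm_num) hN
  have hΛ1 : 1.6 ≤ Λ := by linarith
  have hΛ0 : 0 < Λ := by linarith
  have hNpos : 0 < N := by linarith
  have hmul : 0 < 32 * κ * Λ := by positivity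
  rcases Nat.eq_zero_or_pos R with rfl | hR
  · have : 0 ≤ Real.log (8 * Λ) := Real.log_nonneg (by linarith)
    push_cast
    positivity
  set y : ℕ → ℝ := fun r => m r / (32 * κ * Λ) with hy
  have hya : ∀ r ≤ R, y r ≤ a r := by
    intro r hr
    have h1 := ha1 r hr
    have h2 : Real.log (a r) ≤ Real.log N :=
      Real.log_le_log (by linarith) (by linarith [haN r hr])
    rw [hy, div_le_iff₀ hmul]
    refine (hm r hr).trans ?_
    have h3 : 32 * κ * a r * (1 + Real.log (a r)) ≤ 32 * κ * a r * Λ :=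
      mul_le_mul_of_nonneg_left (by linarith) (by positivity)
    linarith
  have hy1 : 1 / 80 ≤ y 1 := by
    have h1 := hstep 0 hR
    rw [ha0, div_one, mul_one] at h1
    rw [hy, le_div_iff₀ hmul]
    have h2 : Λ ≤ 2.5 * Real.log N := by
      linarith
    have h3 : κ * Λ ≤ κ * (2.5 * Real.log N) := mul_le_mul_of_nonneg_left h2 hκ.le
    simp only [zero_add] at h1
    nlinarith
  have hgrow : ∀ r, 1 ≤ r → r < R → 0 < y r →
      y r * (1 + Real.log (N / y r) / (64 * Λ)) ≤ y (r + 1) := by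
    intro r h1 hr hpos
    have h2 := half_mul_log_div_le hpos (hya r hr.le) (haN r hr.le)
    have h3 := hstep r hr
    rw [show y (r + 1) = m (r + 1) / (32 * κ * Λ) from rfl, le_div_iff₀ hmul]
    have h4 : y r * (32 * κ * Λ) = m r := div_mul_cancel₀ _ hmul.ne'
    have h5 : y r * (1 + Real.log (N / y r) / (64 * Λ)) * (32 * κ * Λ) =
        y r * (32 * κ * Λ) + κ * (y r * Real.log (N / y r) / 2) := by
      field_simp
      ring
    rw [h5, h4]
    have h6 := mul_le_mul_of_nonneg_left h2 hκ.le
    linarith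
  have hlow : ∀ r ≤ R, 0 < y r → Real.log 2 ≤ Real.log (N / y r) := by
    intro r hr hpos
    refine Real.log_le_log (by norm_num) ?_
    rw [le_div_iff₀ hpos]
    linarith [hya r hr, haN r hr]
  have hmain : ∀ k, k + 1 ≤ R → 0 < y (k + 1) ∧
      Real.log (N / y (k + 1)) ≤ 5 * Λ * (1 - 1 / (128 * Λ)) ^ k := by
    have hq : 1 / (128 * Λ) ≤ 1 := by
      rw [div_le_one (by positivity)]
      linarith
    have hq0 : 0 ≤ 1 - 1 / (128 * Λ) := by linarith
    have hq1 : 1 - 1 / (128 * Λ) ≤ 1 := by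
      have : 0 ≤ 1 / (128 * Λ) := by positivity
      linarith
    intro k
    induction k with
    | zero =>
      intro _
      have hpos : 0 < y 1 := by linarith
      refine ⟨hpos, ?_⟩
      have h1 : Real.log (N / y 1) ≤ Real.log (N * 80) := by
        refine Real.log_le_log (by positivity) ?_
        rw [div_le_iff₀ hpos]
        nlinarith
      rw [Real.log_mul hNpos.ne' (by norm_num)] at h1
      have h2 : Real.log 80 ≤ 7 * Real.log 2 := by
        rw [← Real.log_rpow (by norm_num)]
        exact Real.log_le_log (by norm_num) (by norm_num)
      have := Real.log_two_lt_d9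
      simp only [zero_add, pow_zero, mul_one]
      linarith
    | succ k ih =>
      intro hk
      obtain ⟨hpos, hle⟩ := ih (by omega)
      have hl := hlow (k + 1) (by omega) hpos
      have hg := hgrow (k + 1) (by omega) (by omega) hpos
      set l := Real.log (N / y (k + 1)) with hldef
      have hl0 : 0 < l := by linarith
      set x := l / (64 * Λ) with hx
      have hx0 : 0 < x := by positivity
      have hl5 : l ≤ 5 * Λ := by
        refine hle.trans ?_
        have := pow_le_one₀ (n := k) hq0 hq1
        nlinarith
      have hx1 : x ≤ 1 := by
        rw [hx, div_le_one (by positivity)]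
        linarith
      have hpos' : 0 < y (k + 1 + 1) := lt_of_lt_of_le (by positivity) hg
      refine ⟨hpos', ?_⟩
      have hlx : x / 2 ≤ Real.log (1 + x) := by
        have h1 := Real.one_sub_inv_le_log_of_pos (x := 1 + x) (by linarith)
        have h2 : (1 : ℝ) - (1 + x)⁻¹ = x / (1 + x) := by
          field_simp
          ring
        have h3 : x / 2 ≤ x / (1 + x) :=
          div_le_div_of_nonneg_left hx0.le (by linarith) (by linarith)
        linarith
      have h1 : Real.log (N / y (k + 1 + 1)) ≤ Real.log (N / y (k + 1) / (1 + x)) := by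
        refine Real.log_le_log (by positivity) ?_
        rw [div_div]
        exact div_le_div_of_nonneg_left hNpos.le (by positivity) hg
      rw [Real.log_div (x := N / y (k + 1)) (by positivity) (by positivity), ← hldef] at h1
      have h2 : l - x / 2 = l * (1 - 1 / (128 * Λ)) := by
        rw [hx]
        field_simp
        ring
      calc Real.log (N / y (k + 1 + 1)) ≤ l - x / 2 := by linarith
        _ = l * (1 - 1 / (128 * Λ)) := h2
        _ ≤ 5 * Λ * (1 - 1 / (128 * Λ)) ^ k * (1 - 1 / (128 * Λ)) :=
          mul_le_mul_of_nonneg_right hle hq0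
        _ = 5 * Λ * (1 - 1 / (128 * Λ)) ^ (k + 1) := by ring
  obtain ⟨k, rfl⟩ : ∃ k, R = k + 1 := ⟨R - 1, by omega⟩
  obtain ⟨hpos, hle⟩ := hmain k le_rfl
  have hl := hlow (k + 1) le_rfl hpos
  have hexp : (1 - 1 / (128 * Λ)) ^ k ≤ Real.exp (-(k / (128 * Λ))) := by
    have h1 : 1 - 1 / (128 * Λ) ≤ Real.exp (-(1 / (128 * Λ))) := by
      have := Real.add_one_le_exp (-(1 / (128 * Λ)))
      linarith
    have h0 : 0 ≤ 1 - 1 / (128 * Λ) := by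
      have : 1 / (128 * Λ) ≤ 1 := by
        rw [div_le_one (by positivity)]
        linarith
      linarith
    refine (pow_le_pow_left₀ h0 h1 k).trans ?_
    rw [← Real.exp_nat_mul]
    refine Real.exp_le_exp.2 (le_of_eq ?_)
    ring
  have h1 : Real.log 2 ≤ 5 * Λ * Real.exp (-(k / (128 * Λ))) :=
    hl.trans (hle.trans (mul_le_mul_of_nonneg_left hexp (by positivity)))
  have h2 : Real.exp (k / (128 * Λ)) ≤ 8 * Λ := by
    rw [Real.exp_neg] at h1
    have hE := Real.exp_pos (k / (128 * Λ))
    rw [← div_eq_mul_inv, le_div_iff₀ hE] at h1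
    nlinarith
  have h3 : k / (128 * Λ) ≤ Real.log (8 * Λ) := by
    rw [Real.le_log_iff_exp_le (by positivity)]
    exact h2
  rw [div_le_iff₀ (by positivity)] at h3
  push_cast
  linarith

section Ball

variable {V : Type*} [DecidableEq V]

/-- The ball of radius `r` around `v` in the graph that the edge set `X` induces on `L`. -/
def ball (X : Finset (Sym2 V)) (L : Finset V) (v : V) : ℕ → Finset V
  | 0 => {v}
  | r + 1 => ball X L v r ∪ L.filter fun w => ∃ u ∈ ball X L v r, s(u, w) ∈ X

lemma ball_subset {X : Finset (Sym2 V)} {L : Finset V} {v : V} (hv : v ∈ L) (r : ℕ) :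
    ball X L v r ⊆ L := by
  induction r with
  | zero => simpa [ball] using hv
  | succ r ih => exact union_subset ih (filter_subset _ _)

lemma mem_ball_self (X : Finset (Sym2 V)) (L : Finset V) (v : V) (r : ℕ) : v ∈ ball X L v r := by
  induction r with
  | zero => simp [ball]
  | succ r ih => exact mem_union_left _ ih

lemma edist_le_one_of_mem {X : Set (Sym2 V)} {u v : V} (h : s(u, v) ∈ X) :
    (SimpleGraph.fromEdgeSet X).edist u v ≤ 1 := by
  by_cases huv : u = v
  · subst huv
    simp
  · rw [SimpleGraph.edist_eq_one_iff_adj.2]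
    exact (SimpleGraph.fromEdgeSet_adj X).2 ⟨h, huv⟩

lemma edist_le_of_mem_ball {X : Finset (Sym2 V)} {L : Finset V} {v : V} (r : ℕ) :
    ∀ w ∈ ball X L v r, (SimpleGraph.fromEdgeSet (X : Set (Sym2 V))).edist v w ≤ r := by
  induction r with
  | zero =>
    intro w hw
    rw [ball, mem_singleton] at hw
    simp [hw]
  | succ r ih =>
    intro w hw
    rcases mem_union.1 hw with hw | hw
    · refine (ih w hw).trans ?_
      exact_mod_cast Nat.le_succ r
    · obtain ⟨_, u, hu, huw⟩ := mem_filter.1 hw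
      refine (SimpleGraph.edist_triangle (v := u)).trans ?_
      push_cast
      exact add_le_add (ih u hu) (edist_le_one_of_mem huw)

/-- The radius after which balls in expanding sets of size `N` contain more than half of the
vertices. -/
noncomputable def radius (N : ℝ) : ℕ :=
  ⌊128 * (1 + Real.log N) * Real.log (8 * (1 + Real.log N))⌋₊ + 2

/-- A set that expands in `X`, and whose small subsets do not span too many edges of `X`, has
diameter `O (log N log log N)`. -/
lemma edist_le_of_expanding {X : Finset (Sym2 V)} {L W : Finset V} (hLW : L ⊆ W) {κ : ℝ}
    (hκ : 0 < κ) (hW : 2 ≤ #W)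
    (hcut : ∀ S ⊆ L, S.Nonempty → 2 * #S ≤ #W →
      κ * #S * Real.log (#W / #S) ≤ #(cut X S (L \ S)))
    (hin : ∀ S ⊆ L, S.Nonempty → 2 * #S ≤ #W →
      (#(inner X S) : ℝ) ≤ 32 * κ * #S * (1 + Real.log #S))
    {u v : V} (hu : u ∈ L) (hv : v ∈ L) :
    (SimpleGraph.fromEdgeSet (X : Set (Sym2 V))).edist u v ≤ (2 * radius #W : ℕ) := by
  have hW' : (2 : ℝ) ≤ #W := by exact_mod_cast hW
  have key : ∀ x ∈ L, #W < 2 * #(ball X L x (radius #W)) := by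
    intro x hx
    by_contra hc
    have hmono : ∀ r, ball X L x r ⊆ ball X L x (r + 1) := fun r => subset_union_left
    have hmono' : Monotone (ball X L x) := monotone_nat_of_le_succ hmono
    have hsmall : ∀ r ≤ radius #W, 2 * #(ball X L x r) ≤ #W := fun r hr =>
      (Nat.mul_le_mul_left 2 (card_le_card (hmono' hr))).trans (not_lt.1 hc)
    have hne : ∀ r, (ball X L x r).Nonempty := fun r => ⟨x, mem_ball_self X L x r⟩
    have := growth_steps_le hW' hκ (R := radius #W) (m := fun r => #(inner X (ball X L x r)))
      (a := fun r => #(ball X L x r))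
      (fun r _ => by exact_mod_cast (hne r).card_pos)
      (fun r hr => by exact_mod_cast hsmall r hr)
      (by simp [ball]) (by positivity)
      (fun r hr => hin _ (ball_subset hx r) (hne r) (hsmall r hr))
      (fun r hr => by
        refine (add_le_add_right (hcut _ (ball_subset hx r) (hne r) (hsmall r hr.le)) _).trans ?_
        have := card_inner_add_cut_le X (S := ball X L x r) (T := L \ ball X L x r)
          (U := ball X L x (r + 1)) disjoint_sdiff
          (fun a ha b hb hab => mem_union_right _
            (mem_filter.2 ⟨(mem_sdiff.1 hb).1, a, ha, hab⟩)) (hmono r)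
        exact_mod_cast this)
    have hfl := Nat.lt_floor_add_one
      (128 * (1 + Real.log #W) * Real.log (8 * (1 + Real.log #W)))
    rw [radius] at this
    push_cast at this
    linarith
  obtain ⟨w, hwu, hwv⟩ : ∃ w, w ∈ ball X L u (radius #W) ∧ w ∈ ball X L v (radius #W) := by
    by_contra hc
    have hdis : Disjoint (ball X L u (radius #W)) (ball X L v (radius #W)) :=
      disjoint_left.2 fun w h1 h2 => hc ⟨w, h1, h2⟩
    have h1 := key u hu
    have h2 := key v hv
    have h3 := card_le_card (union_subset ((ball_subset (X := X) hu (radius #W)).trans hLW)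
      ((ball_subset (X := X) hv (radius #W)).trans hLW))
    rw [card_union_of_disjoint hdis] at h3
    omega
  refine (SimpleGraph.edist_triangle (v := w)).trans
    ((add_le_add (d := (radius #W : ℕ∞)) (edist_le_of_mem_ball _ w hwu) ?_).trans ?_)
  · rw [SimpleGraph.edist_comm]
    exact edist_le_of_mem_ball _ w hwv
  · rw [two_mul]
    push_cast
    exact le_rfl

end Ball

/-! ### Spanners from bounds on single edges -/

/-- It suffices to bound the distances between the ends of the edges of `G`. -/
lemma isSpanner_of_adj {V : Type*} {G H : SimpleGraph V} {t : ℝ} {k : ℕ} (ht : 0 < t)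
    (hk : (k : ℝ) ≤ t) (hHG : H ≤ G) (h : ∀ u v, G.Adj u v → H.edist u v ≤ k) :
    IsSpanner t G H := by
  refine ⟨hHG, fun u v => ?_⟩
  have hwalk : ∀ {u v : V} (p : G.Walk u v), H.edist u v ≤ k * p.length := by
    intro u v p
    induction p with
    | nil => simp
    | cons hadj p ih =>
      refine SimpleGraph.edist_triangle.trans ((add_le_add (h _ _ hadj) ih).trans ?_)
      rw [SimpleGraph.Walk.length_cons]
      push_cast
      rw [mul_add, mul_one, add_comm]
  by_cases hr : G.Reachable u v
  · obtain ⟨p, hp⟩ := hr.exists_walk_length_eq_edist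
    have h1 := hwalk p
    rw [hp] at h1
    have h2 : ((k * G.edist u v : ℕ∞) : ENNReal) = (k : ENNReal) * (G.edist u v : ENNReal) := by
      simp
    calc (H.edist u v : ENNReal) ≤ ((k * G.edist u v : ℕ∞) : ENNReal) := by exact_mod_cast h1
      _ = (k : ENNReal) * (G.edist u v : ENNReal) := h2
      _ ≤ ENNReal.ofReal t * (G.edist u v : ENNReal) := by
        gcongr
        rw [← ENNReal.ofReal_natCast]
        exact ENNReal.ofReal_le_ofReal hk
  · rw [SimpleGraph.edist_eq_top_of_not_reachable hr]
    have : ENNReal.ofReal t ≠ 0 := by simpa using ht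
    simp [ENNReal.mul_top this]

/-! ### Streaming algorithms from codes of stream prefixes -/

/-- A seed `i`, drawn uniformly and stored in memory once and for all, together with a code of the
stream read so far, is a streaming algorithm, provided that the code of an extended stream depends
only on the code of the old stream and on the new item. The space is the logarithm of the number of
seeds times the number of codes. -/
theorem exists_streamingAlgorithm {n s N : ℕ} (hN : 0 < N) {C : Type*} (T : Finset C)
    (hT : N * #T ≤ 2 ^ s) (Inv : List (EdgeUpdate n) → Prop)
    (hInv : ∀ σ u, Inv (σ ++ [u]) → Inv σ)
    (code : Fin N → List (EdgeUpdate n) → C) (hcode : ∀ i σ, Inv σ → code i σ ∈ T)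
    (hstep : ∀ i σ σ' u, Inv (σ ++ [u]) → Inv (σ' ++ [u]) → code i σ = code i σ' →
      code i (σ ++ [u]) = code i (σ' ++ [u]))
    (out : Fin N → List (EdgeUpdate n) → SimpleGraph (Fin n))
    (hout : ∀ i σ σ', Inv σ → Inv σ' → code i σ = code i σ' → out i σ = out i σ') :
    ∃ A : StreamingAlgorithm n s, ∀ σ, Inv σ → ∀ (P : Set (SimpleGraph (Fin n))) (ε : ℝ),
      (Nat.card {i // out i σ ∉ P} : ℝ) ≤ ε * N →
        ENNReal.ofReal (1 - ε) ≤ (A.outputLaw σ).toOuterMeasure P := by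
  classical
  have : Nonempty (Fin N) := ⟨⟨0, hN⟩⟩
  obtain ⟨e⟩ : Nonempty ({x // x ∈ (univ : Finset (Fin N)) ×ˢ T} ↪ (Fin s → Bool)) := by
    apply Function.Embedding.nonempty_of_card_le
    simpa using hT
  let enc : Fin N × C → (Fin s → Bool) := fun x =>
    if h : x ∈ (univ : Finset (Fin N)) ×ˢ T then e ⟨x, h⟩ else default
  have henc : ∀ i j σ τ, Inv σ → Inv τ → enc (i, code i σ) = enc (j, code j τ) →
      i = j ∧ code i σ = code j τ := by
    intro i j σ τ hσ hτ h
    have h1 : (i, code i σ) ∈ (univ : Finset (Fin N)) ×ˢ T := by simp [hcode i σ hσ]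
    have h2 : (j, code j τ) ∈ (univ : Finset (Fin N)) ×ˢ T := by simp [hcode j τ hτ]
    simp only [enc, dif_pos h1, dif_pos h2] at h
    have := e.injective h
    simpa using this
  let next : (Fin s → Bool) → EdgeUpdate n → (Fin s → Bool) := fun m u =>
    if h : ∃ p : Fin N × List (EdgeUpdate n), Inv (p.2 ++ [u]) ∧ enc (p.1, code p.1 p.2) = m then
      enc (h.choose.1, code h.choose.1 (h.choose.2 ++ [u])) else m
  have hnext : ∀ i σ u, Inv (σ ++ [u]) →
      next (enc (i, code i σ)) u = enc (i, code i (σ ++ [u])) := by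
    intro i σ u h
    have hex : ∃ p : Fin N × List (EdgeUpdate n), Inv (p.2 ++ [u]) ∧
        enc (p.1, code p.1 p.2) = enc (i, code i σ) := ⟨(i, σ), h, rfl⟩
    simp only [next, dif_pos hex]
    obtain ⟨h1, h2⟩ := hex.choose_spec
    obtain ⟨h3, h4⟩ := henc _ _ _ _ (hInv _ _ h1) (hInv _ _ h) h2
    rw [h3] at h4 ⊢
    rw [hstep i _ σ u h1 h h4]
  let final : (Fin s → Bool) → SimpleGraph (Fin n) := fun m =>
    if h : ∃ p : Fin N × List (EdgeUpdate n), Inv p.2 ∧ enc (p.1, code p.1 p.2) = m then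
      out h.choose.1 h.choose.2 else ⊥
  have hfinal : ∀ i σ, Inv σ → final (enc (i, code i σ)) = out i σ := by
    intro i σ h
    have hex : ∃ p : Fin N × List (EdgeUpdate n), Inv p.2 ∧
        enc (p.1, code p.1 p.2) = enc (i, code i σ) := ⟨(i, σ), h, rfl⟩
    simp only [final, dif_pos hex]
    obtain ⟨h1, h2⟩ := hex.choose_spec
    obtain ⟨h3, h4⟩ := henc _ _ _ _ h1 h h2
    rw [h3] at h4 ⊢
    exact hout i _ σ h1 h h4
  let A : StreamingAlgorithm n s :=
    { init := (PMF.uniformOfFintype (Fin N)).map fun i => enc (i, code i [])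
      step := fun m u => PMF.pure (next m u)
      output := final }
  have hrun : ∀ i τ σ, Inv (σ ++ τ) →
      A.runFrom (enc (i, code i σ)) τ = PMF.pure (enc (i, code i (σ ++ τ))) := by
    intro i τ
    induction τ with
    | nil => intro σ _; simp [StreamingAlgorithm.runFrom]
    | cons u τ ih =>
      intro σ h
      have h' : Inv (σ ++ [u] ++ τ) := by simpa using h
      have h'' : Inv (σ ++ [u]) := by
        clear ih
        induction τ using List.reverseRecOn with
        | nil => simpa using h'
        | append_singleton τ w ih =>
          have := hInv (σ ++ [u] ++ τ) w (by simpa using h')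
          exact ih (by simpa using this) this
      have := ih (σ ++ [u]) h'
      simp only [StreamingAlgorithm.runFrom, A, PMF.pure_bind, hnext i σ u h'']
      simpa using this
  refine ⟨A, fun σ hσ P ε hε => ?_⟩
  have hlaw : A.outputLaw σ = (PMF.uniformOfFintype (Fin N)).map fun i => out i σ := by
    have h1 : A.init.bind (fun m => A.runFrom m σ) =
        (PMF.uniformOfFintype (Fin N)).map fun i => enc (i, code i σ) := by
      have h2 : ∀ i, A.runFrom (enc (i, code i [])) σ = PMF.pure (enc (i, code i σ)) := fun i => by
        simpa using hrun i σ [] (by simpa using hσ)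
      simp only [show A.init = (PMF.uniformOfFintype (Fin N)).map fun i => enc (i, code i [])
        from rfl, PMF.bind_map, Function.comp_def, h2]
      rfl
    rw [StreamingAlgorithm.outputLaw, h1, PMF.map_comp]
    congr 1
    funext i
    exact hfinal i σ hσ
  rw [hlaw, PMF.toOuterMeasure_map_apply, PMF.toOuterMeasure_uniformOfFintype_apply]
  have hsplit : Fintype.card ((fun i => out i σ) ⁻¹' P) + Nat.card {i // out i σ ∉ P} = N := by
    rw [← Nat.card_eq_fintype_card]
    have := Nat.card_congr (Equiv.sumCompl fun i => out i σ ∈ P)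
    rw [Nat.card_sum, Nat.card_eq_fintype_card (α := Fin N), Fintype.card_fin] at this
    exact this
  have hNr : (0 : ℝ) < N := by exact_mod_cast hN
  have hreal : 1 - ε ≤ (Fintype.card ((fun i => out i σ) ⁻¹' P) : ℝ) / N := by
    rw [le_div_iff₀ hNr]
    have : (Fintype.card ((fun i => out i σ) ⁻¹' P) : ℝ) + Nat.card {i // out i σ ∉ P} = N := by
      exact_mod_cast hsplit
    linarith
  refine (ENNReal.ofReal_le_ofReal hreal).trans (le_of_eq ?_)
  rw [ENNReal.ofReal_div_of_pos hNr, ENNReal.ofReal_natCast, ENNReal.ofReal_natCast,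
    Fintype.card_fin]

/-! ### Random samples and few seeds -/

section Prob

/-- The probability of `p` under the uniform distribution on a finite type. -/
noncomputable def prob {Ω : Type*} [Fintype Ω] (p : Ω → Prop) : ℝ :=
  Nat.card {ω // p ω} / Fintype.card Ω

variable {Ω : Type*} [Fintype Ω]

lemma prob_eq (p : Ω → Prop) [DecidablePred p] : prob p = #{ω | p ω} / Fintype.card Ω := by
  rw [prob, Nat.card_eq_fintype_card, Fintype.card_subtype]

lemma prob_mono {p q : Ω → Prop} (h : ∀ ω, p ω → q ω) : prob p ≤ prob q := by
  classical
  rw [prob_eq, prob_eq]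
  gcongr with ω
  exact h ω

lemma prob_or_le (p q : Ω → Prop) : prob (fun ω => p ω ∨ q ω) ≤ prob p + prob q := by
  classical
  rw [prob_eq, prob_eq, prob_eq, ← add_div, filter_or]
  gcongr
  exact_mod_cast card_union_le _ _

lemma prob_exists_le {ι : Type*} (s : Finset ι) (p : ι → Ω → Prop) :
    prob (fun ω => ∃ i ∈ s, p i ω) ≤ ∑ i ∈ s, prob (p i) := by
  classical
  rw [prob_eq, sum_congr rfl fun i _ => prob_eq (p i), ← sum_div]
  gcongr
  have : ({ω | ∃ i ∈ s, p i ω} : Finset Ω) = s.biUnion fun i => {ω | p i ω} := by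
    ext ω
    simp
  rw [this]
  exact_mod_cast card_biUnion_le

/-- Markov's inequality. -/
lemma prob_le_sum_div {p : Ω → Prop} {g : Ω → ℝ} (hg : ∀ ω, 0 ≤ g ω) (h : ∀ ω, p ω → 1 ≤ g ω) :
    prob p ≤ (∑ ω, g ω) / Fintype.card Ω := by
  classical
  rw [prob_eq]
  gcongr
  calc (#{ω | p ω} : ℝ) = ∑ ω ∈ ({ω | p ω} : Finset Ω), 1 := by simp
    _ ≤ ∑ ω ∈ ({ω | p ω} : Finset Ω), g ω := sum_le_sum fun ω hω => h ω (mem_filter.1 hω).2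
    _ ≤ ∑ ω, g ω := sum_le_univ_sum_of_nonneg hg

lemma exp_one_lt : Real.exp 1 < 2.72 := by
  have := Real.exp_one_lt_d9
  linarith

/-- If every bad event has probability at most `1 / m`, then few seeds suffice in place of the
whole probability space: each bad event happens for a `3 / m` fraction of them at most. -/
theorem exists_seeds {Δ : Type*} [Fintype Δ] (bad : Δ → Ω → Prop) {m K : ℕ} (hm : 0 < m)
    [Nonempty Ω] (hK : Fintype.card Δ ≤ 2 ^ K) (h : ∀ d, prob (bad d) ≤ 1 / m) :
    ∃ g : Fin (m * (K + 1)) → Ω, ∀ d, (Nat.card {i // bad d (g i)} : ℝ) ≤ 3 * (K + 1) := by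
  classical
  set N := m * (K + 1) with hN
  have hΩ : (0 : ℝ) < Fintype.card Ω := by exact_mod_cast Fintype.card_pos
  have hone : ∀ d, prob (fun g : Fin N → Ω => 3 * (K + 1 : ℝ) < Nat.card {i // bad d (g i)}) ≤
      Real.exp (-(K + 1 : ℝ)) := by
    intro d
    have hZ : ∀ g : Fin N → Ω, Real.exp (Nat.card {i // bad d (g i)}) =
        ∏ i, (if bad d (g i) then Real.exp 1 else 1) := by
      intro g
      rw [prod_ite, prod_const, prod_const_one, mul_one, ← Real.exp_nat_mul, mul_one,
        Nat.card_eq_fintype_card, Fintype.card_subtype]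
    have hsum : ∑ ω, (if bad d ω then Real.exp 1 else 1) ≤
        Fintype.card Ω * Real.exp (1.72 / m) := by
      have h1 : ∑ ω, (if bad d ω then Real.exp 1 else 1) =
          Fintype.card Ω + (Real.exp 1 - 1) * #{ω | bad d ω} := by
        have : ∀ ω, (if bad d ω then Real.exp 1 else 1) =
            1 + (Real.exp 1 - 1) * (if bad d ω then 1 else 0) := by
          intro ω
          split_ifs <;> ring
        rw [sum_congr rfl fun ω _ => this ω, sum_add_distrib, ← mul_sum, sum_boole]
        simp
      have h2 : (#{ω | bad d ω} : ℝ) ≤ Fintype.card Ω * (1 / m) := by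
        have := h d
        rw [prob_eq, div_le_iff₀ hΩ] at this
        linarith
      have h3 := Real.add_one_le_exp (1.72 / m : ℝ)
      have h4 := exp_one_lt
      have h5 : 1 ≤ Real.exp 1 := Real.one_le_exp (by norm_num)
      calc _ = Fintype.card Ω + (Real.exp 1 - 1) * #{ω | bad d ω} := h1
        _ ≤ Fintype.card Ω + 1.72 * (Fintype.card Ω * (1 / m)) := by
            gcongr
            linarith
        _ = Fintype.card Ω * (1.72 / m + 1) := by ring
        _ ≤ _ := by gcongr
    refine (prob_le_sum_div (g := fun g => Real.exp (-(3 * (K + 1))) *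
      Real.exp (Nat.card {i // bad d (g i)})) (fun _ => by positivity) fun g hg => ?_).trans ?_
    · rw [← Real.exp_add]
      exact Real.one_le_exp (by linarith)
    · rw [← mul_sum, sum_congr rfl fun g _ => hZ g,
        ← Fintype.sum_pow (fun ω => if bad d ω then Real.exp 1 else 1) N]
      rw [div_le_iff₀ (by exact_mod_cast Fintype.card_pos)]
      have hpow : (∑ ω, (if bad d ω then Real.exp 1 else 1)) ^ N ≤
          (Fintype.card Ω * Real.exp (1.72 / m)) ^ N :=
        pow_le_pow_left₀ (sum_nonneg fun ω _ => by split_ifs <;> positivity) hsum N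
      refine (mul_le_mul_of_nonneg_left hpow (by positivity)).trans ?_
      rw [mul_pow, ← Real.exp_nat_mul, Fintype.card_fun, Fintype.card_fin, mul_left_comm,
        ← Real.exp_add]
      push_cast
      rw [mul_comm]
      gcongr
      have hm' : (0 : ℝ) < m := by exact_mod_cast hm
      have : (N : ℝ) * (1.72 / m) = 1.72 * (K + 1) := by
        rw [hN]
        push_cast
        field_simp
      rw [this]
      have : (0 : ℝ) ≤ K := by positivity
      linarith
  have hall : prob (fun g : Fin N → Ω => ∃ d ∈ (univ : Finset Δ),
      3 * (K + 1 : ℝ) < Nat.card {i // bad d (g i)}) < 1 := by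
    refine (prob_exists_le _ _).trans_lt ?_
    refine (sum_le_card_nsmul _ _ _ fun d _ => hone d).trans_lt ?_
    rw [nsmul_eq_mul, card_univ]
    have h1 : (Fintype.card Δ : ℝ) ≤ 2 ^ K := by exact_mod_cast hK
    have h2 : (2 : ℝ) ^ K ≤ Real.exp K := by
      have h3 : (2 : ℝ) ≤ Real.exp 1 := by
        have := Real.add_one_le_exp (1 : ℝ)
        linarith
      refine (pow_le_pow_left₀ (by norm_num) h3 K).trans (le_of_eq ?_)
      rw [← Real.exp_nat_mul, mul_one]
    calc (Fintype.card Δ : ℝ) * Real.exp (-(K + 1 : ℝ))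
        ≤ Real.exp K * Real.exp (-(K + 1 : ℝ)) := by
          gcongr
          exact h1.trans h2
      _ = Real.exp (-1) := by
          rw [← Real.exp_add]
          congr 1
          ring
      _ < 1 := by
          rw [Real.exp_lt_one_iff]
          norm_num
  by_contra hc
  push Not at hc
  refine hall.not_ge ?_
  have : ∀ g : Fin N → Ω, ∃ d ∈ (univ : Finset Δ),
      3 * (K + 1 : ℝ) < Nat.card {i // bad d (g i)} := by
    intro g
    obtain ⟨d, hd⟩ := hc g
    exact ⟨d, mem_univ d, hd⟩
  rw [prob_eq, filter_true_of_mem fun g _ => this g, card_univ, div_self]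
  exact_mod_cast Fintype.card_ne_zero

end Prob

section Sample

variable {E : Type*} {l : ℕ}

/-- The level-`i` sample of `A`: each element survives with probability `2⁻ⁱ` (for `i ≤ l`). All
levels are read off from the same random labels `ω`. -/
def sample (ω : E → Fin (2 ^ l)) (i : ℕ) (A : Finset E) : Finset E :=
  A.filter fun e => (ω e : ℕ) < 2 ^ (l - i)

lemma sample_subset (ω : E → Fin (2 ^ l)) (i : ℕ) (A : Finset E) : sample ω i A ⊆ A :=
  filter_subset _ _

lemma sample_zero (ω : E → Fin (2 ^ l)) (A : Finset E) : sample ω 0 A = A :=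
  filter_true_of_mem fun e _ => (ω e).2

variable [Fintype E] [DecidableEq E]

/-- The generating function of the size of a sample, which is binomially distributed. -/
lemma sum_pow_card_sample (i : ℕ) (hi : i ≤ l) (A : Finset E) (z : ℝ) :
    ∑ ω : E → Fin (2 ^ l), z ^ #(sample ω i A) =
      Fintype.card (E → Fin (2 ^ l)) * (1 + (z - 1) / 2 ^ i) ^ #A := by
  have h1 : ∀ ω : E → Fin (2 ^ l), z ^ #(sample ω i A) =
      ∏ e, (if e ∈ A then (if (ω e : ℕ) < 2 ^ (l - i) then z else 1) else 1) := by
    intro ω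
    rw [prod_ite_mem, univ_inter, prod_ite, prod_const, prod_const_one, mul_one, sample]
  have h2 : ∑ x : Fin (2 ^ l), (if (x : ℕ) < 2 ^ (l - i) then z else 1) =
      2 ^ l * (1 + (z - 1) / 2 ^ i) := by
    have h3 : ∀ x : Fin (2 ^ l), (if (x : ℕ) < 2 ^ (l - i) then z else 1) =
        1 + (z - 1) * (if (x : ℕ) < 2 ^ (l - i) then 1 else 0) := by
      intro x
      split_ifs <;> ring
    have h4 : #{x : Fin (2 ^ l) | (x : ℕ) < 2 ^ (l - i)} = 2 ^ (l - i) := by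
      rw [Fin.card_filter_val_lt]
      exact min_eq_right (Nat.pow_le_pow_right (by norm_num) (Nat.sub_le l i))
    rw [sum_congr rfl fun x _ => h3 x, sum_add_distrib, ← mul_sum, sum_boole, h4]
    have h5 : (2 : ℝ) ^ l = 2 ^ (l - i) * 2 ^ i := by rw [← pow_add, Nat.sub_add_cancel hi]
    simp only [sum_const, card_univ, Fintype.card_fin, nsmul_eq_mul, mul_one]
    push_cast
    rw [h5]
    field_simp
  rw [sum_congr rfl fun ω _ => h1 ω]
  have := prod_univ_sum (fun _ : E => (univ : Finset (Fin (2 ^ l))))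
    (fun e x => if e ∈ A then (if (x : ℕ) < 2 ^ (l - i) then z else 1) else (1 : ℝ))
  rw [Fintype.piFinset_univ] at this
  rw [← this]
  have h6 : ∀ e : E, ∑ x : Fin (2 ^ l),
      (if e ∈ A then (if (x : ℕ) < 2 ^ (l - i) then z else 1) else (1 : ℝ)) =
      2 ^ l * (if e ∈ A then (1 + (z - 1) / 2 ^ i) else 1) := by
    intro e
    by_cases he : e ∈ A
    · simp only [he, if_true, h2]
    · simp [he]
  rw [prod_congr rfl fun e _ => h6 e, prod_mul_distrib, prod_ite_mem, univ_inter, prod_const,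
    prod_const, Fintype.card_fun, Fintype.card_fin, card_univ]
  push_cast
  rfl

/-- Chernoff bound for the lower tail. -/
lemma prob_card_sample_le (i : ℕ) (hi : i ≤ l) (A : Finset E) (x : ℝ) :
    prob (fun ω : E → Fin (2 ^ l) => (#(sample ω i A) : ℝ) ≤ x) ≤
      Real.exp (x - #A / 2 ^ i / 2) := by
  have hpos : (0 : ℝ) < Fintype.card (E → Fin (2 ^ l)) := by exact_mod_cast Fintype.card_pos
  refine (prob_le_sum_div (g := fun ω => Real.exp x * Real.exp (-1) ^ #(sample ω i A))
    (fun _ => by positivity) fun ω hω => ?_).trans ?_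
  · rw [← Real.exp_nat_mul, ← Real.exp_add]
    exact Real.one_le_exp (by linarith)
  · rw [← mul_sum, sum_pow_card_sample i hi, div_le_iff₀ hpos]
    have he : Real.exp (-1) ≤ 1 / 2 := by
      rw [Real.exp_neg]
      have := Real.add_one_le_exp (1 : ℝ)
      rw [inv_le_comm₀ (by positivity) (by norm_num)]
      linarith
    have h0 : 0 ≤ 1 + (Real.exp (-1) - 1) / 2 ^ i := by
      have h1 : (1 - Real.exp (-1)) / 2 ^ i ≤ 1 := by
        rw [div_le_one (by positivity)]
        have : (1 : ℝ) ≤ 2 ^ i := one_le_pow₀ (by norm_num)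
        have := Real.exp_pos (-1)
        linarith
      have h2 : (Real.exp (-1) - 1) / 2 ^ i = -((1 - Real.exp (-1)) / 2 ^ i) := by ring
      linarith
    have h3 : 1 + (Real.exp (-1) - 1) / 2 ^ i ≤ Real.exp (-(1 / 2 ^ i / 2)) := by
      have h4 := Real.add_one_le_exp (-(1 / 2 ^ i / 2) : ℝ)
      have h5 : (Real.exp (-1) - 1) / 2 ^ i ≤ (-(1 / 2)) / 2 ^ i := by
        gcongr
        linarith
      have h6 : (-(1 / 2) : ℝ) / 2 ^ i = -(1 / 2 ^ i / 2) := by ring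
      linarith
    have h7 := pow_le_pow_left₀ h0 h3 #A
    rw [← Real.exp_nat_mul] at h7
    calc Real.exp x * (Fintype.card (E → Fin (2 ^ l)) * (1 + (Real.exp (-1) - 1) / 2 ^ i) ^ #A)
        ≤ Real.exp x * (Fintype.card (E → Fin (2 ^ l)) *
          Real.exp (#A * -(1 / 2 ^ i / 2))) := by gcongr
      _ = Real.exp (x - #A / 2 ^ i / 2) * Fintype.card (E → Fin (2 ^ l)) := by
        rw [mul_left_comm, ← Real.exp_add, mul_comm]
        congr 2
        ring

/-- Chernoff bound for the upper tail. -/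
lemma prob_le_card_sample (i : ℕ) (hi : i ≤ l) (A : Finset E) (x : ℝ) :
    prob (fun ω : E → Fin (2 ^ l) => x ≤ (#(sample ω i A) : ℝ)) ≤
      Real.exp (2 * (#A / 2 ^ i) - x) := by
  have hpos : (0 : ℝ) < Fintype.card (E → Fin (2 ^ l)) := by exact_mod_cast Fintype.card_pos
  refine (prob_le_sum_div (g := fun ω => Real.exp (-x) * Real.exp 1 ^ #(sample ω i A))
    (fun _ => by positivity) fun ω hω => ?_).trans ?_
  · rw [← Real.exp_nat_mul, ← Real.exp_add]
    exact Real.one_le_exp (by linarith)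
  · rw [← mul_sum, sum_pow_card_sample i hi, div_le_iff₀ hpos]
    have he := exp_one_lt
    have he1 : 1 ≤ Real.exp 1 := Real.one_le_exp (by norm_num)
    have h0 : 0 ≤ 1 + (Real.exp 1 - 1) / 2 ^ i := by
      have : 0 ≤ (Real.exp 1 - 1) / 2 ^ i := div_nonneg (by linarith) (by positivity)
      linarith
    have h3 : 1 + (Real.exp 1 - 1) / 2 ^ i ≤ Real.exp (2 / 2 ^ i) := by
      have h4 := Real.add_one_le_exp (2 / 2 ^ i : ℝ)
      have h5 : (Real.exp 1 - 1) / 2 ^ i ≤ 2 / 2 ^ i := by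
        gcongr
        linarith
      linarith
    have h7 := pow_le_pow_left₀ h0 h3 #A
    rw [← Real.exp_nat_mul] at h7
    calc Real.exp (-x) * (Fintype.card (E → Fin (2 ^ l)) * (1 + (Real.exp 1 - 1) / 2 ^ i) ^ #A)
        ≤ Real.exp (-x) * (Fintype.card (E → Fin (2 ^ l)) *
          Real.exp (#A * (2 / 2 ^ i))) := by gcongr
      _ = Real.exp (2 * (#A / 2 ^ i) - x) * Fintype.card (E → Fin (2 ^ l)) := by
        rw [mul_left_comm, ← Real.exp_add, mul_comm]
        congr 2
        ring

end Sample

/-! ### Sparse recovery from power sums and the number of small sets -/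

section PowerSums

variable {E : Type*}

/-- The power sums of a set, as a linear sketch over `ZMod p`. -/
def powerSum {p : ℕ} (φ : E → ZMod p) (A : Finset E) (k : ℕ) : ZMod p :=
  ∑ a ∈ A, φ a ^ k

lemma powerSum_insert [DecidableEq E] {p : ℕ} (φ : E → ZMod p) {A : Finset E} {e : E}
    (he : e ∉ A) (k : ℕ) : powerSum φ (insert e A) k = powerSum φ A k + φ e ^ k := by
  rw [powerSum, sum_insert he, add_comm]
  rfl

lemma powerSum_erase [DecidableEq E] {p : ℕ} (φ : E → ZMod p) {A : Finset E} {e : E}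
    (he : e ∈ A) (k : ℕ) : powerSum φ (A.erase e) k = powerSum φ A k - φ e ^ k := by
  rw [powerSum, sum_erase_eq_sub he]
  rfl

open Polynomial in
/-- A set of at most `s` elements is determined by its first `2 s` power sums. The zeroth one
reveals the number of elements; sets of equal size are separated by a polynomial that vanishes at
all but one of the points. -/
theorem eq_of_powerSum_eq [Fintype E] [DecidableEq E] {p : ℕ} [Fact p.Prime] {φ : E → ZMod p}
    (hφ : Function.Injective φ) (hp : Fintype.card E < p) {s : ℕ} (hs : 0 < s) {A B : Finset E}
    (hA : #A ≤ s) (h : ∀ k < 2 * s, powerSum φ A k = powerSum φ B k) : A = B := by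
  have hcard : #A = #B := by
    have h0 := h 0 (by omega)
    simp only [powerSum, pow_zero, sum_const, nsmul_eq_mul, mul_one] at h0
    rw [ZMod.natCast_eq_natCast_iff'] at h0
    rwa [Nat.mod_eq_of_lt ((card_le_univ A).trans_lt hp),
      Nat.mod_eq_of_lt ((card_le_univ B).trans_lt hp)] at h0
  refine eq_of_subset_of_card_le (fun a ha => ?_) hcard.ge
  by_contra hb
  set q : (ZMod p)[X] := ∏ b ∈ (A ∪ B).erase a, (X - C (φ b)) with hq
  have hdeg : q.natDegree < 2 * s := by
    rw [hq, natDegree_prod_of_monic _ _ fun b _ => monic_X_sub_C _]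
    simp only [natDegree_X_sub_C, sum_const, smul_eq_mul, mul_one]
    rw [card_erase_of_mem (mem_union_left _ ha)]
    have := card_union_le A B
    omega
  have heval : ∀ S : Finset E, ∑ x ∈ S, q.eval (φ x) =
      ∑ k ∈ range (2 * s), q.coeff k * powerSum φ S k := by
    intro S
    rw [sum_congr rfl fun x _ => eval_eq_sum_range' hdeg (φ x), sum_comm]
    exact sum_congr rfl fun k _ => by rw [powerSum, mul_sum]
  have hzero : ∀ b ∈ (A ∪ B).erase a, q.eval (φ b) = 0 := by
    intro b hb
    rw [hq, eval_prod]
    exact prod_eq_zero hb (by simp)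
  have h1 : ∑ x ∈ A, q.eval (φ x) = q.eval (φ a) := by
    refine sum_eq_single_of_mem a ha fun b hb hba => hzero b ?_
    exact mem_erase.2 ⟨hba, mem_union_left _ hb⟩
  have h2 : ∑ x ∈ B, q.eval (φ x) = 0 := by
    refine sum_eq_zero fun b hb' => hzero b ?_
    exact mem_erase.2 ⟨fun hba => hb (hba ▸ hb'), mem_union_right _ hb'⟩
  have h3 : ∑ x ∈ A, q.eval (φ x) = ∑ x ∈ B, q.eval (φ x) := by
    rw [heval, heval]
    exact sum_congr rfl fun k hk => by rw [h k (mem_range.1 hk)]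
  rw [h1, h2, hq, eval_prod, prod_eq_zero_iff] at h3
  obtain ⟨b, hb', hb0⟩ := h3
  rw [eval_sub, eval_X, eval_C, sub_eq_zero] at hb0
  exact (mem_erase.1 hb').1 (hφ hb0).symm

end PowerSums

section SmallSets

/-- The subsets of `α` with at most `k` elements. -/
def smallSets (α : Type*) [Fintype α] (k : ℕ) : Finset (Finset α) :=
  (univ : Finset α).powerset.filter fun s => #s ≤ k

lemma mem_smallSets {α : Type*} [Fintype α] {k : ℕ} {s : Finset α} :
    s ∈ smallSets α k ↔ #s ≤ k := by
  simp [smallSets]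

lemma card_smallSets_le {α : Type*} [Fintype α] {b : ℕ} (hb : Fintype.card α + 1 ≤ 2 ^ b)
    (k : ℕ) : #(smallSets α k) ≤ 2 ^ (b * k) := by
  classical
  have h1 : #(smallSets α k) ≤ #(univ : Finset (Fin k → Option α)) := by
    refine card_le_card_of_surjOn (fun g => univ.filter fun a => ∃ i, g i = some a) ?_
    intro s hs
    rw [mem_coe, mem_smallSets] at hs
    refine ⟨fun i => if h : (i : ℕ) < #s then some (s.equivFin.symm ⟨i, h⟩ : α) else none,
      by simp, ?_⟩
    ext a
    simp only [mem_filter, mem_univ, true_and]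
    constructor
    · rintro ⟨i, hi⟩
      split_ifs at hi with h
      rw [Option.some_inj] at hi
      rw [← hi]
      exact Subtype.prop _
    · intro ha
      refine ⟨⟨s.equivFin ⟨a, ha⟩, (s.equivFin ⟨a, ha⟩).2.trans_le hs⟩, ?_⟩
      simp
  refine h1.trans ?_
  rw [card_univ, Fintype.card_fun, Fintype.card_fin, Fintype.card_option, pow_mul]
  exact Nat.pow_le_pow_left hb k

end SmallSets

/-! ### Edge streams and the logarithmic scale -/

section Streams

variable {n : ℕ}

/-- The edge set that is present after a stream. -/
def edges (σ : List (EdgeUpdate n)) : Finset (Sym2 (Fin n)) :=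
  σ.foldl EdgeUpdate.apply ∅

lemma edges_append (σ : List (EdgeUpdate n)) (u : EdgeUpdate n) :
    edges (σ ++ [u]) = u.apply (edges σ) := by
  simp [edges]

lemma isValidStreamFrom_append (σ : List (EdgeUpdate n)) (u : EdgeUpdate n) :
    ∀ E, IsValidStreamFrom E (σ ++ [u]) ↔
      IsValidStreamFrom E σ ∧ u.IsLegal (σ.foldl EdgeUpdate.apply E) := by
  induction σ with
  | nil => intro E; simp [IsValidStreamFrom]
  | cons w σ ih =>
    intro E
    rw [List.cons_append, IsValidStreamFrom, IsValidStreamFrom, ih, and_assoc, List.foldl_cons]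

lemma isValidStream_append {σ : List (EdgeUpdate n)} {u : EdgeUpdate n} :
    IsValidStream (σ ++ [u]) ↔ IsValidStream σ ∧ u.IsLegal (edges σ) :=
  isValidStreamFrom_append σ u ∅

lemma numDeletions_append (σ : List (EdgeUpdate n)) (u : EdgeUpdate n) :
    numDeletions (σ ++ [u]) = numDeletions σ + if u.isDeletion then 1 else 0 := by
  simp [numDeletions, List.countP_append, List.countP_cons]

/-- Streams with at most `f` deletions that are valid. -/
def IsAdmissible (f : ℕ) (σ : List (EdgeUpdate n)) : Prop :=
  IsValidStream σ ∧ numDeletions σ ≤ f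

lemma IsAdmissible.of_append {f : ℕ} {σ : List (EdgeUpdate n)} {u : EdgeUpdate n}
    (h : IsAdmissible f (σ ++ [u])) : IsAdmissible f σ := by
  refine ⟨(isValidStream_append.1 h.1).1, ?_⟩
  have := h.2
  rw [numDeletions_append] at this
  omega

lemma streamGraph_eq (σ : List (EdgeUpdate n)) :
    streamGraph σ = SimpleGraph.fromEdgeSet (edges σ : Set (Sym2 (Fin n))) :=
  rfl

end Streams

section Scale

/-- The binary length of `n`, the logarithmic factor in all space bounds. -/
def scale (n : ℕ) : ℕ :=
  Nat.log 2 n + 1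

lemma lt_two_pow_scale (n : ℕ) : n < 2 ^ scale n :=
  Nat.lt_pow_succ_log_self (by norm_num) n

lemma one_le_scale (n : ℕ) : 1 ≤ scale n :=
  Nat.succ_le_succ (Nat.zero_le _)

lemma log_le_scale {n : ℕ} (hn : 0 < n) : Real.log n ≤ scale n := by
  have h1 : (n : ℝ) ≤ Real.exp (scale n) := by
    have h2 : (n : ℝ) ≤ 2 ^ scale n := by exact_mod_cast (lt_two_pow_scale n).le
    have h3 : (2 : ℝ) ≤ Real.exp 1 := by
      have := Real.add_one_le_exp (1 : ℝ)
      linarith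
    refine h2.trans ((pow_le_pow_left₀ (by norm_num) h3 _).trans (le_of_eq ?_))
    rw [← Real.exp_nat_mul, mul_one]
  rwa [Real.log_le_iff_le_exp (by exact_mod_cast hn)]

lemma log_three_gt : 1.08 ≤ Real.log 3 := by
  rw [Real.le_log_iff_exp_le (by norm_num)]
  have h1 : Real.exp 1.08 = Real.exp 1 * Real.exp 0.08 := by
    rw [← Real.exp_add]
    norm_num
  have h2 : Real.exp 0.08 ≤ 1 / (1 - 0.08) := by
    have h3 := Real.add_one_le_exp (-0.08 : ℝ)
    rw [Real.exp_neg] at h3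
    rw [le_div_iff₀ (by norm_num)]
    have h4 := Real.exp_pos 0.08
    have h5 := mul_le_mul_of_nonneg_left h3 h4.le
    rw [mul_inv_cancel₀ h4.ne'] at h5
    linarith
  rw [h1]
  have := Real.exp_one_lt_d9
  have := Real.exp_pos 1
  norm_num at h2
  nlinarith

lemma log_ge {n : ℕ} (hn : 3 ≤ n) : 1.08 ≤ Real.log n :=
  log_three_gt.trans (Real.log_le_log (by norm_num) (by exact_mod_cast hn))

lemma scale_le {n : ℕ} (hn : 3 ≤ n) : (scale n : ℝ) ≤ 3 * Real.log n := by
  have h1 : (2 : ℝ) ^ Nat.log 2 n ≤ n := by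
    exact_mod_cast Nat.pow_log_le_self 2 (by omega)
  have h2 := Real.log_le_log (by positivity) h1
  rw [Real.log_pow] at h2
  have h3 := Real.log_two_gt_d9
  have h4 := log_ge hn
  have h5 : (0 : ℝ) ≤ Nat.log 2 n := by positivity
  rw [scale]
  push_cast
  nlinarith

lemma card_sym2_le {n : ℕ} (hn : 0 < n) : Fintype.card (Sym2 (Fin n)) ≤ n * n := by
  rw [Sym2.card, Fintype.card_fin, Nat.choose_two_right, Nat.add_sub_cancel]
  refine Nat.div_le_of_le_mul ?_
  nlinarith

/-- Pairs of vertices are numbers of `2 * scale n` bits. -/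
lemma card_sym2_add_one_le {n : ℕ} (hn : 0 < n) :
    Fintype.card (Sym2 (Fin n)) + 1 ≤ 2 ^ (2 * scale n) := by
  have h1 := card_sym2_le hn
  have h2 := lt_two_pow_scale n
  rw [two_mul, pow_add]
  nlinarith

lemma radius_mono {a b : ℝ} (ha : 1 ≤ a) (hab : a ≤ b) : radius a ≤ radius b := by
  have h1 : Real.log a ≤ Real.log b := Real.log_le_log (by linarith) hab
  have h0 : 0 ≤ Real.log a := Real.log_nonneg ha
  have h2 : Real.log (8 * (1 + Real.log a)) ≤ Real.log (8 * (1 + Real.log b)) :=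
    Real.log_le_log (by linarith) (by linarith)
  have h3 : 0 ≤ Real.log (8 * (1 + Real.log a)) := Real.log_nonneg (by linarith)
  unfold radius
  gcongr
  linarith

/-- The stretch, as a multiple of `log n log log n`; all additive constants are absorbed, since
`log log n` is bounded away from `0` for `n ≥ 3`. -/
lemma radius_le {n : ℕ} (hn : 3 ≤ n) :
    ((2 * radius n + 2 : ℕ) : ℝ) ≤ 30000 * (Real.log n * Real.log (Real.log n)) := by
  have h1 := log_ge hn
  have h0 : 0 < Real.log n := by linarith
  have h2 : 0.074 ≤ Real.log (Real.log n) := by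
    have h3 := Real.one_sub_inv_le_log_of_pos h0
    have h4 : (Real.log n)⁻¹ ≤ (1.08 : ℝ)⁻¹ := inv_anti₀ (by norm_num) h1
    norm_num at h4 ⊢
    linarith
  have h3 : Real.log (8 * (1 + Real.log n)) ≤ 40 * Real.log (Real.log n) := by
    have h4 : Real.log (8 * (1 + Real.log n)) ≤ Real.log (16 * Real.log n) :=
      Real.log_le_log (by linarith) (by linarith)
    rw [Real.log_mul (by norm_num) h0.ne'] at h4
    have h5 : Real.log 16 = 4 * Real.log 2 := by
      rw [← Real.log_rpow (by norm_num)]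
      norm_num
    have := Real.log_two_lt_d9
    linarith
  have h5 : 0 ≤ Real.log (8 * (1 + Real.log n)) := Real.log_nonneg (by linarith)
  have h6 : 128 * (1 + Real.log n) * Real.log (8 * (1 + Real.log n)) ≤
      128 * (2 * Real.log n) * (40 * Real.log (Real.log n)) := by
    gcongr
    linarith
  have h7 := Nat.floor_le (a := 128 * (1 + Real.log n) * Real.log (8 * (1 + Real.log n)))
    (by positivity)
  have h8 : 0.079 ≤ Real.log n * Real.log (Real.log n) := by nlinarith
  rw [radius]
  push_cast
  linarith

end Scale

section DenseSets

variable {V : Type*} [DecidableEq V]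

lemma IsDense.two_le_card {D : ℕ} {E : Finset (Sym2 V)} {W : Finset V} (h : IsDense D E W)
    (hD : 2 ≤ D) : 2 ≤ #W := by
  by_contra hc
  have h1 : #W = 1 := by
    have := h.1.card_pos
    omega
  have h2 := h.2
  have h3 : #(inner E W) ≤ 1 := by
    refine (card_le_card inter_subset_right).trans ?_
    rw [card_sym2, h1]
    decide
  have h4 : (#(inner E W) : ℝ) ≤ 1 := by exact_mod_cast h3
  have h5 : (2 : ℝ) ≤ D := by exact_mod_cast hD
  rw [h1] at h2
  norm_num at h2
  linarith

lemma IsDense.mul_card_le {D : ℕ} {E : Finset (Sym2 V)} {W : Finset V} (h : IsDense D E W) :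
    D * #W ≤ #(inner E W) := by
  have h1 : (1 : ℝ) ≤ #W := by exact_mod_cast h.1.card_pos
  have h2 := Real.log_nonneg h1
  have h3 : (D : ℝ) * #W ≤ D * #W * (1 + Real.log #W) :=
    le_mul_of_one_le_right (by positivity) (by linarith)
  exact_mod_cast h3.trans h.2

lemma not_isDense_empty {D : ℕ} (hD : 0 < D) (W : Finset V) : ¬ IsDense D ∅ W := by
  intro h
  have h1 := h.mul_card_le
  have h2 := h.1.card_pos
  rw [inner, empty_inter, card_empty] at h1
  have := Nat.mul_pos hD h2
  omega

/-- Adding one edge to an edge set without dense sets produces only dense sets that contain it. -/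
lemma IsDense.mem_inner_insert {D : ℕ} {B : Finset (Sym2 V)} {e : Sym2 V} {W : Finset V}
    (h : IsDense D (insert e B) W) (hB : ¬ IsDense D B W) : e ∈ inner (insert e B) W := by
  by_contra hc
  have h1 : ¬ ∀ v ∈ e, v ∈ W := fun h' => hc (mem_inner.2 ⟨mem_insert_self e B, h'⟩)
  refine hB ⟨h.1, h.2.trans ?_⟩
  have : inner (insert e B) W ⊆ inner B W := by
    intro x hx
    rw [mem_inner, mem_insert] at hx
    rw [mem_inner]
    rcases hx with ⟨rfl | hx, h2⟩
    · exact absurd h2 h1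
    · exact ⟨hx, h2⟩
  exact_mod_cast card_le_card this

lemma card_le_of_not_isDense {n D : ℕ} (hn : 0 < n) {B : Finset (Sym2 (Fin n))}
    (hB : ∀ W, ¬ IsDense D B W) : #B ≤ D * n * (2 * scale n) := by
  have : Nonempty (Fin n) := ⟨⟨0, hn⟩⟩
  have h1 : inner B univ = B := by
    ext e
    simp [mem_inner]
  have h2 := hB univ
  simp only [IsDense, univ_nonempty, true_and, not_le, h1, card_univ, Fintype.card_fin] at h2
  have h3 := log_le_scale hn
  have h4 : (1 : ℝ) ≤ scale n := by exact_mod_cast one_le_scale n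
  have h5 : (D : ℝ) * n * (1 + Real.log n) ≤ D * n * (2 * scale n) :=
    mul_le_mul_of_nonneg_left (by linarith) (by positivity)
  exact_mod_cast (h2.le.trans h5)

end DenseSets

/-! ### Few deletions: edges inside dense sets are dropped -/

section FewDeletions

variable {n : ℕ}

open Classical in
/-- One step of the algorithm for few deletions: an inserted edge is dropped if it completes a
dense set. -/
noncomputable def sparseStep (D : ℕ) (B : Finset (Sym2 (Fin n))) :
    EdgeUpdate n → Finset (Sym2 (Fin n))
  | .insert e => if ∃ W, IsDense D (insert e B) W then B else insert e B
  | .delete e => B.erase e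

/-- The edges stored after a stream. -/
noncomputable def sparseEdges (D : ℕ) (σ : List (EdgeUpdate n)) : Finset (Sym2 (Fin n)) :=
  σ.foldl (sparseStep D) ∅

lemma sparseEdges_append (D : ℕ) (σ : List (EdgeUpdate n)) (u : EdgeUpdate n) :
    sparseEdges D (σ ++ [u]) = sparseStep D (sparseEdges D σ) u := by
  simp [sparseEdges]

lemma not_isDense_sparseEdges {D : ℕ} (hD : 0 < D) (σ : List (EdgeUpdate n)) :
    ∀ W, ¬ IsDense D (sparseEdges D σ) W := by
  induction σ using List.reverseRecOn with
  | nil => exact not_isDense_empty hD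
  | append_singleton σ u ih =>
    rw [sparseEdges_append]
    cases u with
    | insert e =>
      simp only [sparseStep]
      split_ifs with h
      · exact ih
      · exact not_exists.1 h
    | delete e => exact fun W hW => ih W (hW.mono (erase_subset _ _))

/-- Dropped edges lie in a minimal dense set of edges that have been lost only by later deletions
(or that are the dropped edge itself). -/
lemma sparseEdges_spec {D : ℕ} (hD : 0 < D) (σ : List (EdgeUpdate n)) (hσ : IsValidStream σ) :
    sparseEdges D σ ⊆ edges σ ∧ ∀ e ∈ edges σ, e ∉ sparseEdges D σ →
      ∃ E W, IsMinDense D E W ∧ e ∈ inner E W ∧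
        #(E \ sparseEdges D σ) ≤ numDeletions σ + 1 := by
  induction σ using List.reverseRecOn with
  | nil => simp [sparseEdges, edges]
  | append_singleton σ u ih =>
    obtain ⟨hσ', hu⟩ := isValidStream_append.1 hσ
    obtain ⟨ih1, ih2⟩ := ih hσ'
    rw [sparseEdges_append, edges_append, numDeletions_append]
    set B := sparseEdges D σ with hB
    cases u with
    | insert e =>
      simp only [sparseStep, EdgeUpdate.apply, EdgeUpdate.isDeletion, Bool.false_eq_true, if_false,
        add_zero]
      split_ifs with h
      · refine ⟨ih1.trans (subset_insert _ _), fun x hx hxB => ?_⟩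
        rcases mem_insert.1 hx with rfl | hx
        · obtain ⟨W, hW⟩ := h
          obtain ⟨W', hW'⟩ := hW.exists_minDense
          refine ⟨insert x B, W', hW', hW'.prop.mem_inner_insert
            (not_isDense_sparseEdges hD σ W'), ?_⟩
          have : insert x B \ B ⊆ {x} := by
            intro y hy
            rw [mem_sdiff, mem_insert] at hy
            simpa [hy.2] using hy.1
          have := card_le_card this
          rw [card_singleton] at this
          omega
        · exact ih2 x hx hxB
      · refine ⟨insert_subset_insert _ ih1, fun x hx hxB => ?_⟩
        rw [mem_insert, not_or] at hxB
        obtain ⟨E, W, h1, h2, h3⟩ := ih2 x ((mem_insert.1 hx).resolve_left hxB.1) hxB.2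
        exact ⟨E, W, h1, h2,
          (card_le_card (sdiff_subset_sdiff subset_rfl (subset_insert _ _))).trans h3⟩
    | delete e =>
      simp only [sparseStep, EdgeUpdate.apply, EdgeUpdate.isDeletion, if_true]
      refine ⟨erase_subset_erase _ ih1, fun x hx hxB => ?_⟩
      rw [mem_erase] at hx hxB
      obtain ⟨E, W, h1, h2, h3⟩ := ih2 x hx.2 fun hc => hxB ⟨hx.1, hc⟩
      refine ⟨E, W, h1, h2, ?_⟩
      have : E \ B.erase e ⊆ insert e (E \ B) := by
        intro y hy
        rw [mem_sdiff, mem_erase, not_and'] at hy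
        rw [mem_insert, mem_sdiff]
        by_cases hyB : y ∈ B
        · exact Or.inl (not_not.1 (hy.2 hyB))
        · exact Or.inr ⟨hy.1, hyB⟩
      have := (card_le_card this).trans (card_insert_le _ _)
      omega

/-- Since `D` exceeds eight times the number of lost edges, all vertices of a minimal dense set
remain lightly damaged. -/
lemma isSpanner_sparseEdges (hn : 3 ≤ n) {f : ℕ} {σ : List (EdgeUpdate n)}
    (hσ : IsAdmissible f σ) :
    IsSpanner (30000 * (Real.log n * Real.log (Real.log n))) (streamGraph σ)
      (SimpleGraph.fromEdgeSet (sparseEdges (16 * (f + 1)) σ : Set (Sym2 (Fin n)))) := by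
  set D := 16 * (f + 1) with hD
  set B := sparseEdges D σ with hB
  obtain ⟨h1, h2⟩ := sparseEdges_spec (D := D) (by omega) σ hσ.1
  have hrad := radius_le hn
  have ht : (0 : ℝ) < ((2 * radius n + 2 : ℕ) : ℝ) := by positivity
  refine isSpanner_of_adj (k := 2 * radius n + 2) (ht.trans_le hrad) hrad ?_ ?_
  · rw [streamGraph_eq]
    exact SimpleGraph.fromEdgeSet_mono (by exact_mod_cast h1)
  · intro u v huv
    rw [streamGraph_eq, SimpleGraph.fromEdgeSet_adj] at huv
    by_cases huvB : s(u, v) ∈ B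
    · refine (edist_le_one_of_mem (X := (B : Set (Sym2 (Fin n)))) huvB).trans ?_
      exact_mod_cast Nat.succ_le_succ (Nat.zero_le _)
    · obtain ⟨E, W, hW, he, hcard⟩ := h2 _ (by exact_mod_cast huv.1) huvB
      have hcard' : #(E \ B) ≤ f + 1 := hcard.trans (Nat.succ_le_succ hσ.2)
      have hlight : light D (E \ B) W = W := by
        refine filter_true_of_mem fun w _ => ?_
        have := card_le_card (filter_subset (fun e => w ∈ e) (E \ B))
        change 8 * #((E \ B).filter fun e => w ∈ e) < D
        omega
      have hW2 := hW.prop.two_le_card (by omega : 2 ≤ D)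
      have hmem := (mem_inner.1 he).2
      have hdist := edist_le_of_expanding (X := E \ (E \ B)) (subset_refl W)
        (κ := D / 2) (by positivity) hW2
        (fun S hS hne hSW => by
          have := hW.le_card_cut_light (F := E \ B) (by rw [hlight, sdiff_self]; simp) hne
            (by rwa [hlight]) hSW
          rw [hlight] at this
          refine le_trans (le_of_eq ?_) this
          ring)
        (fun S hS hne hSW => by
          have hss : S ⊂ W := by
            refine ⟨hS, fun hc => ?_⟩
            have := card_le_card hc
            have := hne.card_pos
            omega
          have h3 : (#(inner (E \ (E \ B)) S) : ℝ) ≤ #(inner E S) := by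
            exact_mod_cast card_le_card (inner_mono sdiff_subset S)
          have h4 := hW.card_inner_le hne hss
          have h5 : (1 : ℝ) ≤ #S := by exact_mod_cast hne.card_pos
          have h6 := Real.log_nonneg h5
          have h7 : (0 : ℝ) ≤ D * #S * (1 + Real.log #S) := by positivity
          linarith)
        (hmem u (Sym2.mem_mk_left u v)) (hmem v (Sym2.mem_mk_right u v))
      have hsub : E \ (E \ B) ⊆ B := by
        intro x hx
        rw [mem_sdiff, mem_sdiff, not_and, not_not] at hx
        exact hx.2 hx.1
      refine (SimpleGraph.edist_anti (SimpleGraph.fromEdgeSet_mono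
        (by exact_mod_cast hsub))).trans (hdist.trans ?_)
      have hWn : #W ≤ n := by simpa using card_le_univ W
      have := radius_mono (a := #W) (b := n) (by exact_mod_cast hW.prop.1.card_pos)
        (by exact_mod_cast hWn)
      exact_mod_cast (by omega : 2 * radius #W ≤ 2 * radius n + 2)

/-- The deterministic algorithm that stores `sparseEdges`. Its space is small enough if `f² < n`. -/
theorem exists_algorithm_few_deletions (hn : 3 ≤ n) (f : ℕ) :
    ∃ A : StreamingAlgorithm n (2 * scale n * (16 * (f + 1) * n * (2 * scale n))),
      ∀ σ, IsAdmissible f σ → ENNReal.ofReal (1 - 1 / (n : ℝ) ^ 100) ≤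
        (A.outputLaw σ).toOuterMeasure
          {H | IsSpanner (30000 * (Real.log n * Real.log (Real.log n))) (streamGraph σ) H} := by
  set D := 16 * (f + 1) with hD
  obtain ⟨A, hA⟩ := exists_streamingAlgorithm (n := n) (N := 1)
    (s := 2 * scale n * (D * n * (2 * scale n))) one_pos
    (smallSets (Sym2 (Fin n)) (D * n * (2 * scale n)))
    (by rw [one_mul]; exact card_smallSets_le (card_sym2_add_one_le (by omega)) _)
    (IsAdmissible f) (fun σ u h => h.of_append)
    (fun _ σ => sparseEdges D σ)
    (fun _ σ _ => mem_smallSets.2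
      (card_le_of_not_isDense (by omega) (not_isDense_sparseEdges (by omega) σ)))
    (fun _ σ σ' u _ _ h => by
      rw [sparseEdges_append, sparseEdges_append, h])
    (fun _ σ => SimpleGraph.fromEdgeSet (sparseEdges D σ : Set (Sym2 (Fin n))))
    (fun _ σ σ' _ _ h => by
      rw [h])
  refine ⟨A, fun σ hσ => hA σ hσ _ _ ?_⟩
  have : IsEmpty {i : Fin 1 // SimpleGraph.fromEdgeSet (sparseEdges D σ : Set (Sym2 (Fin n))) ∉
      {H | IsSpanner (30000 * (Real.log n * Real.log (Real.log n))) (streamGraph σ) H}} :=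
    ⟨fun x => x.2 (isSpanner_sparseEdges hn hσ)⟩
  rw [Nat.card_of_isEmpty]
  push_cast
  positivity

end FewDeletions

/-! ### Random samples of dense sets and of neighbourhoods -/

section BadEvents

variable {V : Type*} [DecidableEq V] {l : ℕ}

lemma cut_sample_sdiff (ω : Sym2 V → Fin (2 ^ l)) (i : ℕ) (E F : Finset (Sym2 V))
    (S T : Finset V) : cut (sample ω i E \ F) S T = sample ω i (cut (E \ F) S T) := by
  ext e
  simp only [mem_cut, sample, mem_sdiff, mem_filter]
  tauto

lemma inner_sample_sdiff_subset (ω : Sym2 V → Fin (2 ^ l)) (i : ℕ) (E F : Finset (Sym2 V))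
    (S : Finset V) : inner (sample ω i E \ F) S ⊆ sample ω i (inner E S) := by
  intro e
  simp only [mem_inner, sample, mem_sdiff, mem_filter]
  tauto

/-- The sample of `E` without `F` expands on the lightly damaged vertices of `W`, and its small
sets span few edges. -/
def GoodExpansion (c : ℝ) (D i : ℕ) (W : Finset V) (E F : Finset (Sym2 V))
    (ω : Sym2 V → Fin (2 ^ l)) : Prop :=
  ∀ S ⊆ light D F W, S.Nonempty → 2 * #S ≤ #W →
    c / 8 * #S * Real.log (#W / #S) ≤ #(cut (sample ω i E \ F) S (light D F W \ S)) ∧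
    (#(inner (sample ω i E \ F) S) : ℝ) ≤ 32 * (c / 8) * #S * (1 + Real.log #S)

/-- Some level of the sample of `A` is small enough to be recovered and contains an element of
`A'`. -/
def GoodLevel (s L : ℕ) (A A' : Finset (Sym2 V)) (ω : Sym2 V → Fin (2 ^ l)) : Prop :=
  ∃ i ≤ L, (sample ω i A').Nonempty ∧ #(sample ω i A) ≤ s

variable [Fintype V]

/-- The union bound over all vertex sets `S` is affordable, since the failure probability decreases
geometrically with the size of `S`. -/
lemma prob_not_goodExpansion_le {c x : ℝ} {D i : ℕ} (hi : i ≤ l) {W : Finset V}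
    {E F : Finset (Sym2 V)} (hc : 0 ≤ c) (hD : (D : ℝ) = 2 ^ i * c) (hW : IsMinDense D E W)
    (hheavy : 8 * #(W \ light D F W) ≤ D) (hx : Real.exp (-(c / 16)) ≤ x)
    (hxn : Fintype.card V * x ≤ 1) :
    prob (fun ω : Sym2 V → Fin (2 ^ l) => ¬ GoodExpansion c D i W E F ω) ≤
      4 * (Fintype.card V * x) := by
  have hx0 : 0 < x := (Real.exp_pos _).trans_le hx
  set fam : Finset (Finset V) := univ.filter fun S => S ⊆ light D F W ∧ S.Nonempty ∧
    2 * #S ≤ #W with hfam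
  have h1 : prob (fun ω : Sym2 V → Fin (2 ^ l) => ¬ GoodExpansion c D i W E F ω) ≤
      prob (fun ω : Sym2 V → Fin (2 ^ l) => ∃ S ∈ fam,
        (#(sample ω i (cut (E \ F) S (light D F W \ S))) : ℝ) ≤
            c / 8 * #S * Real.log (#W / #S) ∨
        32 * (c / 8) * #S * (1 + Real.log #S) ≤ #(sample ω i (inner E S))) := by
    refine prob_mono fun ω hω => ?_
    simp only [GoodExpansion, not_forall] at hω
    obtain ⟨S, hS1, hS2, hS3, hS⟩ := hω
    refine ⟨S, by simp [hfam, hS1, hS2, hS3], ?_⟩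
    rw [cut_sample_sdiff, not_and_or, not_le, not_le] at hS
    refine hS.imp le_of_lt fun h => h.le.trans ?_
    exact_mod_cast card_le_card (inner_sample_sdiff_subset ω i E F S)
  have h2i : (0 : ℝ) < 2 ^ i := by positivity
  have hterm : ∀ S ∈ fam, prob (fun ω : Sym2 V → Fin (2 ^ l) =>
        (#(sample ω i (cut (E \ F) S (light D F W \ S))) : ℝ) ≤
            c / 8 * #S * Real.log (#W / #S) ∨
        32 * (c / 8) * #S * (1 + Real.log #S) ≤ #(sample ω i (inner E S))) ≤ 2 * x ^ #S := by
    intro S hS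
    obtain ⟨hSL, hne, hcard⟩ := (mem_filter.1 hS).2
    have hSpos : (1 : ℝ) ≤ #S := by exact_mod_cast hne.card_pos
    have hlogS := Real.log_nonneg hSpos
    have hlog : (1 : ℝ) / 2 ≤ Real.log (#W / #S) := by
      have h2le : (2 : ℝ) ≤ #W / #S := by
        rw [le_div_iff₀ (by linarith)]
        exact_mod_cast hcard
      have := Real.log_le_log (by norm_num) h2le
      have := Real.log_two_gt_d9
      linarith
    have hpow : Real.exp (-(c / 16) * #S) ≤ x ^ #S := by
      rw [mul_comm, Real.exp_nat_mul]
      exact pow_le_pow_left₀ (Real.exp_pos _).le hx _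
    have hcut := hW.le_card_cut_light hheavy hne hSL hcard
    have hss : S ⊂ W := by
      refine ⟨hSL.trans (light_subset _ _ _), fun hc => ?_⟩
      have := card_le_card hc
      have := hne.card_pos
      omega
    have hinn := hW.card_inner_le hne hss
    rw [hD] at hcut hinn
    refine (prob_or_le _ _).trans ?_
    rw [two_mul]
    refine add_le_add ((prob_card_sample_le i hi _ _).trans (le_trans ?_ hpow))
      ((prob_le_card_sample i hi _ _).trans (le_trans ?_ hpow))
    · refine Real.exp_le_exp.2 ?_
      have h3 : c * #S * Real.log (#W / #S) / 2 ≤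
          #(cut (E \ F) S (light D F W \ S)) / 2 ^ i := by
        rw [le_div_iff₀ h2i]
        refine le_trans (le_of_eq ?_) hcut
        ring
      have h4 : c * #S * (1 / 2) ≤ c * #S * Real.log (#W / #S) :=
        mul_le_mul_of_nonneg_left hlog (by positivity)
      linarith
    · refine Real.exp_le_exp.2 ?_
      have h3 : (#(inner E S) : ℝ) / 2 ^ i ≤ c * #S * (1 + Real.log #S) := by
        rw [div_le_iff₀ h2i]
        refine hinn.trans (le_of_eq ?_)
        ring
      have h4 : c * #S * 1 ≤ c * #S * (1 + Real.log #S) :=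
        mul_le_mul_of_nonneg_left (by linarith) (by positivity)
      have h5 : 0 ≤ c * #S := by positivity
      linarith
  have hsum : ∑ S ∈ fam, 2 * x ^ #S ≤ 4 * (Fintype.card V * x) := by
    have h3 : ∑ S ∈ fam, x ^ #S ≤ ∑ S ∈ (univ : Finset V).powerset.erase ∅, x ^ #S := by
      refine sum_le_sum_of_subset_of_nonneg (fun S hS => ?_) fun _ _ _ => by positivity
      have := (mem_filter.1 hS).2.2.1
      simpa [nonempty_iff_ne_empty] using this
    have h4 : ∑ S ∈ (univ : Finset V).powerset.erase ∅, x ^ #S = (x + 1) ^ Fintype.card V - 1 := by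
      have h5 := sum_pow_mul_eq_add_pow x 1 (univ : Finset V)
      simp only [one_pow, mul_one, card_univ] at h5
      rw [← h5, sum_erase_eq_sub (empty_mem_powerset _)]
      simp
    have h5 : (x + 1) ^ Fintype.card V ≤ Real.exp (Fintype.card V * x) := by
      rw [Real.exp_nat_mul]
      exact pow_le_pow_left₀ (by positivity) (Real.add_one_le_exp x) _
    have h6 : Real.exp (Fintype.card V * x) - 1 ≤ 2 * (Fintype.card V * x) := by
      have h0 : 0 ≤ (Fintype.card V : ℝ) * x := by positivity
      have := Real.abs_exp_sub_one_le (x := Fintype.card V * x) (by rwa [abs_of_nonneg h0])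
      rw [abs_of_nonneg h0] at this
      exact (le_abs_self _).trans this
    rw [← mul_sum]
    linarith
  exact h1.trans ((prob_exists_le fam _).trans ((sum_le_sum hterm).trans hsum))

/-- At the level where `A` is expected to have between `s / 16` and `s / 8` sampled elements, it
has at most `s` of them, and one of them lies in `A'`. -/
lemma prob_not_goodLevel_le {s L : ℕ} (hL : L ≤ l) {A A' : Finset (Sym2 V)} (hs : 8 ≤ s)
    (hA : s < #A) (hAL : #A ≤ 2 ^ L) (hAA' : #A ≤ 2 * #A') :
    prob (fun ω : Sym2 V → Fin (2 ^ l) => ¬ GoodLevel s L A A' ω) ≤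
      2 * Real.exp (-(s / 64)) := by
  classical
  have hex : ∃ i, 8 * #A ≤ 2 ^ i * s := ⟨L, by nlinarith⟩
  set i := Nat.find hex with hi
  have hi1 : 8 * #A ≤ 2 ^ i * s := Nat.find_spec hex
  have hiL : i ≤ L := Nat.find_min' hex (by nlinarith)
  have hi0 : i ≠ 0 := by
    intro h0
    rw [h0] at hi1
    omega
  obtain ⟨k, hk⟩ := Nat.exists_eq_succ_of_ne_zero hi0
  have hi2 : 2 ^ k * s < 8 * #A := by
    have := Nat.find_min hex (m := k) (by omega)
    omega
  have hpow : (2 : ℝ) ^ i = 2 * 2 ^ k := by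
    rw [hk, pow_succ]
    ring
  have h2i : (0 : ℝ) < 2 ^ i := by positivity
  have hup : (#A : ℝ) / 2 ^ i ≤ s / 8 := by
    rw [div_le_iff₀ h2i]
    have : (8 : ℝ) * #A ≤ 2 ^ i * s := by exact_mod_cast hi1
    linarith
  have hlo : (s : ℝ) / 32 ≤ #A' / 2 ^ i := by
    rw [le_div_iff₀ h2i, hpow]
    have h1 : (2 : ℝ) ^ k * s ≤ 8 * #A := by exact_mod_cast hi2.le
    have h2 : (#A : ℝ) ≤ 2 * #A' := by exact_mod_cast hAA'
    linarith
  have hsub : prob (fun ω : Sym2 V → Fin (2 ^ l) => ¬ GoodLevel s L A A' ω) ≤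
      prob (fun ω : Sym2 V → Fin (2 ^ l) =>
        (#(sample ω i A') : ℝ) ≤ 0 ∨ (s : ℝ) ≤ #(sample ω i A)) := by
    refine prob_mono fun ω hω => ?_
    by_contra hc
    push Not at hc
    refine hω ⟨i, hiL, ?_, ?_⟩
    · rw [← card_pos]
      exact_mod_cast hc.1
    · exact_mod_cast hc.2.le
  refine hsub.trans ((prob_or_le _ _).trans ?_)
  rw [two_mul]
  refine add_le_add ((prob_card_sample_le i (hiL.trans hL) _ _).trans (Real.exp_le_exp.2 ?_))
    ((prob_le_card_sample i (hiL.trans hL) _ _).trans (Real.exp_le_exp.2 ?_))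
  · linarith
  · have : (0 : ℝ) ≤ s := by positivity
    linarith

end BadEvents

/-! ### Many deletions: the evolution of clusters -/

section Clusters

variable {n : ℕ}

/-- The randomness-free history of a stream: the current edge set, the clusters created so far
(`W j` for `j < len`), the edges that were handed over to a cluster at its creation, and the edges
that have ever been deleted. -/
structure History (n : ℕ) where
  /-- the current edge set -/
  cur : Finset (Sym2 (Fin n))
  /-- the edges inside a cluster when it was created -/
  orig : Finset (Sym2 (Fin n))
  /-- the edges deleted so far -/
  del : Finset (Sym2 (Fin n))
  /-- the number of clusters -/
  len : ℕ
  /-- the clusters in the order of their creation, followed by empty sets -/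
  W : ℕ → Finset (Fin n)

/-- Some cluster contains both ends of `e`. -/
def Covered (W : ℕ → Finset (Fin n)) (len : ℕ) (e : Sym2 (Fin n)) : Prop :=
  ∃ j < len, e ∈ (W j).sym2

/-- `W j` is the first cluster that contains both ends of `e`. -/
def Owns (W : ℕ → Finset (Fin n)) (j : ℕ) (e : Sym2 (Fin n)) : Prop :=
  e ∈ (W j).sym2 ∧ ∀ i < j, e ∉ (W i).sym2

lemma Covered.exists_owns {W : ℕ → Finset (Fin n)} {len : ℕ} {e : Sym2 (Fin n)}
    (h : Covered W len e) : ∃ j < len, Owns W j e := by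
  classical
  have hex : ∃ j, e ∈ (W j).sym2 := by
    obtain ⟨j, _, hj⟩ := h
    exact ⟨j, hj⟩
  obtain ⟨j, hj, hje⟩ := h
  exact ⟨Nat.find hex, (Nat.find_min' hex hje).trans_lt hj, Nat.find_spec hex,
    fun i hi => Nat.find_min hex hi⟩

open Classical in
/-- The edges inside no cluster. They are stored explicitly. -/
noncomputable def History.buf (g : History n) : Finset (Sym2 (Fin n)) :=
  g.cur.filter fun e => ¬ Covered g.W g.len e

open Classical in
/-- A minimal dense set for `B`, or the empty set if there is none. -/
noncomputable def pick (D : ℕ) (B : Finset (Sym2 (Fin n))) : Finset (Fin n) :=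
  if h : ∃ W, IsMinDense D B W then h.choose else ∅

lemma pick_spec {D : ℕ} {B : Finset (Sym2 (Fin n))} (h : pick D B ≠ ∅) :
    IsMinDense D B (pick D B) := by
  classical
  unfold pick at h ⊢
  split_ifs at h ⊢ with h'
  · exact h'.choose_spec
  · exact absurd rfl h

lemma not_isDense_of_pick_eq {D : ℕ} {B : Finset (Sym2 (Fin n))} (h : pick D B = ∅) :
    ∀ W, ¬ IsDense D B W := by
  classical
  intro W hW
  have hex : ∃ W, IsMinDense D B W := hW.exists_minDense
  rw [pick, dif_pos hex] at h
  exact hex.choose_spec.prop.1.ne_empty h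

open Classical in
/-- An inserted edge that no cluster covers is buffered; if this creates a dense set in the buffer,
then a minimal one becomes a new cluster. -/
noncomputable def History.step (D : ℕ) (g : History n) : EdgeUpdate n → History n
  | .insert e =>
    if Covered g.W g.len e ∨ pick D (insert e g.buf) = ∅ then
      { g with cur := insert e g.cur }
    else
      { g with
        cur := insert e g.cur
        orig := g.orig ∪ inner (insert e g.buf) (pick D (insert e g.buf))
        len := g.len + 1
        W := Function.update g.W g.len (pick D (insert e g.buf)) }
  | .delete e => { g with cur := g.cur.erase e, del := insert e g.del }

/-- The history of a stream. -/
noncomputable def history (D : ℕ) (σ : List (EdgeUpdate n)) : History n :=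
  σ.foldl (History.step D) ⟨∅, ∅, ∅, 0, fun _ => ∅⟩

lemma history_append (D : ℕ) (σ : List (EdgeUpdate n)) (u : EdgeUpdate n) :
    history D (σ ++ [u]) = (history D σ).step D u := by
  simp [history]

/-- The properties of the histories of streams. -/
structure History.Valid (D : ℕ) (g : History n) : Prop where
  not_isDense : ∀ W, ¬ IsDense D g.buf W
  exists_minDense : ∀ j < g.len, ∃ E ⊆ g.orig, IsMinDense D E (g.W j)
  W_eq_empty : ∀ j, g.len ≤ j → g.W j = ∅
  orig_sdiff_del_subset : g.orig \ g.del ⊆ g.cur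
  covered_orig : ∀ e ∈ g.orig, Covered g.W g.len e
  card_le : D * ∑ j ∈ range g.len, #(g.W j) ≤ #g.orig

lemma buf_insert_of_covered {g : History n} {e : Sym2 (Fin n)} (h : Covered g.W g.len e) :
    ({ g with cur := insert e g.cur } : History n).buf = g.buf := by
  classical
  simp only [History.buf, filter_insert, h, not_true, if_false]

lemma buf_insert_of_not_covered {g : History n} {e : Sym2 (Fin n)}
    (h : ¬ Covered g.W g.len e) :
    ({ g with cur := insert e g.cur } : History n).buf = insert e g.buf := by
  classical
  simp only [History.buf, filter_insert, h, not_false_eq_true, if_true]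

lemma covered_update {W : ℕ → Finset (Fin n)} {len : ℕ} {S : Finset (Fin n)}
    {e : Sym2 (Fin n)} :
    Covered (Function.update W len S) (len + 1) e ↔ Covered W len e ∨ e ∈ S.sym2 := by
  constructor
  · rintro ⟨j, hj, he⟩
    rcases Nat.lt_succ_iff_lt_or_eq.1 hj with hj | rfl
    · rw [Function.update_of_ne hj.ne] at he
      exact Or.inl ⟨j, hj, he⟩
    · rw [Function.update_self] at he
      exact Or.inr he
  · rintro (⟨j, hj, he⟩ | he)
    · exact ⟨j, hj.trans (Nat.lt_succ_self _), by rwa [Function.update_of_ne hj.ne]⟩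
    · exact ⟨len, Nat.lt_succ_self _, by rwa [Function.update_self]⟩

lemma buf_new_cluster (g : History n) (e : Sym2 (Fin n)) (S : Finset (Fin n))
    (O : Finset (Sym2 (Fin n))) (h : ¬ Covered g.W g.len e) :
    (⟨insert e g.cur, O, g.del, g.len + 1, Function.update g.W g.len S⟩ : History n).buf =
      insert e g.buf \ inner (insert e g.buf) S := by
  classical
  ext x
  simp only [History.buf, mem_filter, covered_update, mem_sdiff, inner, mem_inter, mem_insert]
  constructor
  · rintro ⟨hx, hc⟩
    rw [not_or] at hc
    exact ⟨hx.imp id fun hx => ⟨hx, hc.1⟩, fun h' => hc.2 h'.2⟩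
  · rintro ⟨hx, hc⟩
    refine ⟨hx.imp id And.left, fun h' => ?_⟩
    rcases h' with h' | h'
    · rcases hx with rfl | hx
      · exact h h'
      · exact hx.2 h'
    · exact hc ⟨hx, h'⟩

lemma History.Valid.step {D : ℕ} {g : History n} (hg : g.Valid D) (u : EdgeUpdate n) :
    (g.step D u).Valid D := by
  classical
  cases u with
  | insert e =>
    by_cases hc : Covered g.W g.len e
    · simp only [History.step, hc, true_or, if_true]
      exact ⟨by rw [buf_insert_of_covered hc]; exact hg.not_isDense, hg.exists_minDense,
        hg.W_eq_empty, hg.orig_sdiff_del_subset.trans (subset_insert _ _), hg.covered_orig,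
        hg.card_le⟩
    · by_cases hp : pick D (insert e g.buf) = ∅
      · simp only [History.step, hp, or_true, if_true]
        exact ⟨by rw [buf_insert_of_not_covered hc]; exact not_isDense_of_pick_eq hp,
          hg.exists_minDense, hg.W_eq_empty,
          hg.orig_sdiff_del_subset.trans (subset_insert _ _), hg.covered_orig, hg.card_le⟩
      · simp only [History.step, hc, hp, or_self, if_false]
        have hmin := pick_spec hp
        set S := pick D (insert e g.buf) with hS
        have he : e ∈ inner (insert e g.buf) S :=
          hmin.prop.mem_inner_insert (hg.not_isDense S)
        have hbuf : g.buf ⊆ g.cur := filter_subset _ _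
        refine ⟨?_, ?_, ?_, ?_, ?_, ?_⟩
        · rw [buf_new_cluster g e S _ hc]
          refine fun W hW => hg.not_isDense W (hW.mono fun x hx => ?_)
          rw [mem_sdiff, mem_insert] at hx
          rcases hx.1 with rfl | hx'
          · exact absurd he hx.2
          · exact hx'
        · intro j hj
          rcases Nat.lt_succ_iff_lt_or_eq.1 hj with hj | rfl
          · obtain ⟨E, hE, h⟩ := hg.exists_minDense j hj
            refine ⟨E, hE.trans subset_union_left, ?_⟩
            dsimp only
            rwa [Function.update_of_ne hj.ne]
          · refine ⟨_, subset_union_right, ?_⟩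
            dsimp only
            rw [Function.update_self]
            exact hmin.restrict
        · intro j hj
          dsimp only at hj ⊢
          rw [Function.update_of_ne (by omega)]
          exact hg.W_eq_empty j (by omega)
        · intro x hx
          dsimp only at hx ⊢
          rw [mem_sdiff, mem_union] at hx
          rcases hx.1 with h | h
          · exact mem_insert_of_mem (hg.orig_sdiff_del_subset (mem_sdiff.2 ⟨h, hx.2⟩))
          · exact insert_subset_insert e hbuf (mem_inner.1 h).1
        · intro x hx
          dsimp only at hx ⊢
          rw [covered_update]
          rcases mem_union.1 hx with h | h
          · exact Or.inl (hg.covered_orig x h)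
          · exact Or.inr (mem_inter.1 h).2
        · dsimp only
          rw [sum_range_succ, Function.update_self, mul_add, card_union_of_disjoint]
          · refine add_le_add (le_trans (le_of_eq ?_) hg.card_le) hmin.prop.mul_card_le
            congr 1
            refine sum_congr rfl fun j hj => ?_
            rw [Function.update_of_ne (mem_range.1 hj).ne]
          · rw [disjoint_left]
            intro x hx hx'
            rcases mem_insert.1 (mem_inner.1 hx').1 with rfl | h
            · exact hc (hg.covered_orig _ hx)
            · exact (mem_filter.1 h).2 (hg.covered_orig _ hx)
  | delete e =>
    refine ⟨fun W hW => hg.not_isDense W (hW.mono ?_), hg.exists_minDense, hg.W_eq_empty, ?_,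
      hg.covered_orig, hg.card_le⟩
    · exact filter_subset_filter _ (erase_subset _ _)
    · intro x hx
      simp only [History.step, mem_sdiff, mem_insert, not_or] at hx
      exact mem_erase.2 ⟨hx.2.1, hg.orig_sdiff_del_subset (mem_sdiff.2 ⟨hx.1, hx.2.2⟩)⟩

lemma cur_history {D : ℕ} (σ : List (EdgeUpdate n)) : (history D σ).cur = edges σ := by
  induction σ using List.reverseRecOn with
  | nil => rfl
  | append_singleton σ u ih =>
    rw [history_append, edges_append, ← ih]
    cases u with
    | insert e =>
      simp only [History.step, EdgeUpdate.apply]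
      split_ifs <;> rfl
    | delete e => rfl

lemma card_del_history_le {D : ℕ} (σ : List (EdgeUpdate n)) :
    #(history D σ).del ≤ numDeletions σ := by
  induction σ using List.reverseRecOn with
  | nil => simp [history]
  | append_singleton σ u ih =>
    rw [history_append, numDeletions_append]
    cases u with
    | insert e =>
      simp only [History.step]
      split_ifs <;> exact le_add_right ih
    | delete e =>
      simp only [History.step, EdgeUpdate.isDeletion, if_true]
      exact (card_insert_le _ _).trans (Nat.succ_le_succ ih)

lemma valid_history {D : ℕ} (hD : 0 < D) (σ : List (EdgeUpdate n)) :
    (history D σ).Valid D := by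
  induction σ using List.reverseRecOn with
  | nil =>
    refine ⟨not_isDense_empty hD, ?_, fun _ _ => rfl, ?_, ?_, ?_⟩ <;> simp [history]
  | append_singleton σ u ih =>
    rw [history_append]
    exact ih.step u

lemma History.Valid.len_le {D : ℕ} {g : History n} (hg : g.Valid D) :
    g.len ≤ ∑ j ∈ range g.len, #(g.W j) := by
  have : ∑ j ∈ range g.len, 1 ≤ ∑ j ∈ range g.len, #(g.W j) := by
    refine sum_le_sum fun j hj => ?_
    obtain ⟨E, _, hE⟩ := hg.exists_minDense j (mem_range.1 hj)
    exact hE.prop.1.card_pos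
  simpa using this

end Clusters

/-! ### Many deletions: the memory content and the output -/

section Sketch

variable {n : ℕ}

open Classical in
/-- The edges of `C` at `v` that belong to the cluster `W j`. -/
noncomputable def clusterStar (W : ℕ → Finset (Fin n)) (C : Finset (Sym2 (Fin n))) (j : ℕ)
    (v : Fin n) : Finset (Sym2 (Fin n)) :=
  C.filter fun e => Owns W j e ∧ v ∈ e

lemma mem_clusterStar {W : ℕ → Finset (Fin n)} {C : Finset (Sym2 (Fin n))} {j : ℕ} {v : Fin n}
    {e : Sym2 (Fin n)} : e ∈ clusterStar W C j v ↔ e ∈ C ∧ Owns W j e ∧ v ∈ e := by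
  classical
  simp [clusterStar]

lemma clusterStar_eq_empty {W : ℕ → Finset (Fin n)} (C : Finset (Sym2 (Fin n))) {j : ℕ}
    {v : Fin n} (hv : v ∉ W j) : clusterStar W C j v = ∅ := by
  rw [eq_empty_iff_forall_notMem]
  intro e he
  obtain ⟨_, ho, hve⟩ := mem_clusterStar.1 he
  exact hv (mem_sym2_iff.1 ho.1 v hve)

variable {l p : ℕ}

/-- The linear sketch of the level-`i` sample of `clusterStar W C j v`. -/
noncomputable def sketch (φ : Sym2 (Fin n) → ZMod p) (ω : Sym2 (Fin n) → Fin (2 ^ l))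
    (W : ℕ → Finset (Fin n)) (C : Finset (Sym2 (Fin n))) (j : ℕ) (v : Fin n) (i k : ℕ) : ZMod p :=
  powerSum φ (sample ω i (clusterStar W C j v)) k

open Classical in
lemma sketch_insert (φ : Sym2 (Fin n) → ZMod p) (ω : Sym2 (Fin n) → Fin (2 ^ l))
    (W : ℕ → Finset (Fin n)) {C : Finset (Sym2 (Fin n))} {e : Sym2 (Fin n)} (he : e ∉ C) (j : ℕ)
    (v : Fin n) (i k : ℕ) : sketch φ ω W (insert e C) j v i k = sketch φ ω W C j v i k +
      if (Owns W j e ∧ v ∈ e) ∧ (ω e : ℕ) < 2 ^ (l - i) then φ e ^ k else 0 := by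
  unfold sketch clusterStar sample
  rw [filter_filter, filter_filter, filter_insert]
  split_ifs with h
  · rw [powerSum_insert _ fun h' => he (mem_filter.1 h').1]
  · rw [add_zero]

open Classical in
lemma sketch_erase (φ : Sym2 (Fin n) → ZMod p) (ω : Sym2 (Fin n) → Fin (2 ^ l))
    (W : ℕ → Finset (Fin n)) {C : Finset (Sym2 (Fin n))} {e : Sym2 (Fin n)} (he : e ∈ C) (j : ℕ)
    (v : Fin n) (i k : ℕ) : sketch φ ω W (C.erase e) j v i k = sketch φ ω W C j v i k -
      if (Owns W j e ∧ v ∈ e) ∧ (ω e : ℕ) < 2 ^ (l - i) then φ e ^ k else 0 := by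
  unfold sketch clusterStar sample
  rw [filter_filter, filter_filter, Finset.filter_erase _ e C]
  split_ifs with h
  · rw [powerSum_erase _ (mem_filter.2 ⟨he, h⟩)]
  · rw [sub_zero, erase_eq_of_notMem]
    exact fun h' => h (mem_filter.1 h').2

/-- A set, if it is small enough to be stored. -/
def trunc {E : Type*} (q : ℕ) (Y : Finset E) : Option (Finset E) :=
  if #Y ≤ q then some Y else none

lemma trunc_union_congr {E : Type*} [DecidableEq E] {q : ℕ} {Y Y' : Finset E}
    (h : trunc q Y = trunc q Y') (Z : Finset E) : trunc q (Y ∪ Z) = trunc q (Y' ∪ Z) := by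
  unfold trunc at h
  split_ifs at h with h1 h2 h2
  · rw [Option.some_inj.1 h]
  · have h3 : ¬ #(Y ∪ Z) ≤ q := fun h' => h1 ((card_le_card subset_union_left).trans h')
    have h4 : ¬ #(Y' ∪ Z) ≤ q := fun h' => h2 ((card_le_card subset_union_left).trans h')
    rw [trunc, trunc, if_neg h3, if_neg h4]

/-- Two histories that are indistinguishable for the algorithm: its memory holds the clusters, the
buffer, the deleted edges, a sample of the original cluster edges (unless it is too large), and the
sketches of the current cluster edges at each vertex and each sampling level. -/
structure Agree (φ : Sym2 (Fin n) → ZMod p) (ω : Sym2 (Fin n) → Fin (2 ^ l)) (i₀ q L s : ℕ)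
    (g g' : History n) : Prop where
  len : g.len = g'.len
  W : g.W = g'.W
  buf : g.buf = g'.buf
  del : g.del = g'.del
  orig : trunc q (sample ω i₀ g.orig) = trunc q (sample ω i₀ g'.orig)
  sketch : ∀ j v, ∀ i ≤ L, ∀ k < 2 * s,
    sketch φ ω g.W g.cur j v i k = sketch φ ω g'.W g'.cur j v i k

lemma sample_union (ω : Sym2 (Fin n) → Fin (2 ^ l)) (i : ℕ) (A B : Finset (Sym2 (Fin n))) :
    sample ω i (A ∪ B) = sample ω i A ∪ sample ω i B :=
  filter_union _ _ _

/-- The stars of the old clusters do not change when a cluster is added. -/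
lemma clusterStar_update_of_lt (W : ℕ → Finset (Fin n)) (C : Finset (Sym2 (Fin n))) {len j : ℕ}
    (hj : j < len) (S : Finset (Fin n)) (v : Fin n) :
    clusterStar (Function.update W len S) C j v = clusterStar W C j v := by
  ext x
  simp only [mem_clusterStar, Owns]
  rw [Function.update_of_ne hj.ne]
  have : (∀ i < j, x ∉ (Function.update W len S i).sym2) ↔ ∀ i < j, x ∉ (W i).sym2 := by
    refine forall₂_congr fun i hi => ?_
    rw [Function.update_of_ne (hi.trans hj).ne]
  rw [this]

/-- The stars of a new cluster consist of buffered edges. -/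
lemma clusterStar_update_self (W : ℕ → Finset (Fin n)) (C : Finset (Sym2 (Fin n))) (len : ℕ)
    (S : Finset (Fin n)) (v : Fin n) :
    clusterStar (Function.update W len S) C len v =
      clusterStar (fun _ => S) (C.filter fun e => ∀ j < len, e ∉ (W j).sym2) 0 v := by
  ext x
  simp only [mem_clusterStar, Owns, mem_filter, Function.update_self]
  have : (∀ i < len, x ∉ (Function.update W len S i).sym2) ↔ ∀ i < len, x ∉ (W i).sym2 := by
    refine forall₂_congr fun i hi => ?_
    rw [Function.update_of_ne hi.ne]
  rw [this]
  simp only [Nat.not_lt_zero, false_imp_iff, implies_true, and_true]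
  tauto

lemma filter_eq_insert_buf {g : History n} {e : Sym2 (Fin n)} (hc : ¬ Covered g.W g.len e) :
    (insert e g.cur).filter (fun e => ∀ j < g.len, e ∉ (g.W j).sym2) = insert e g.buf := by
  classical
  rw [← buf_insert_of_not_covered hc, History.buf]
  refine filter_congr fun x _ => ?_
  simp only [Covered, not_exists, not_and]

/-- The memory content can be updated. The sketches are linear; those of a new cluster can be
computed, since its edges are explicitly known at this moment. -/
theorem Agree.step {D : ℕ} {φ : Sym2 (Fin n) → ZMod p} {ω : Sym2 (Fin n) → Fin (2 ^ l)}
    {i₀ q L s : ℕ} {g g' : History n} (h : Agree φ ω i₀ q L s g g') (hg : g.Valid D)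
    {u : EdgeUpdate n} (hu : u.IsLegal g.cur) (hu' : u.IsLegal g'.cur) :
    Agree φ ω i₀ q L s (g.step D u) (g'.step D u) := by
  classical
  cases u with
  | insert e =>
    have hins : ∀ j v, ∀ i ≤ L, ∀ k < 2 * s, DynamicSpanner.sketch φ ω g.W (insert e g.cur) j v i k
        = DynamicSpanner.sketch φ ω g'.W (insert e g'.cur) j v i k := by
      intro j v i hi k hk
      rw [sketch_insert _ _ _ hu.2, sketch_insert _ _ _ hu'.2, h.sketch j v i hi k hk, h.W]
    by_cases hc : Covered g.W g.len e
    · have hc' : Covered g'.W g'.len e := by rwa [← h.W, ← h.len]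
      simp only [History.step, hc, hc', true_or, if_true]
      exact ⟨h.len, h.W, by rw [buf_insert_of_covered hc, buf_insert_of_covered hc', h.buf],
        h.del, h.orig, hins⟩
    · have hc' : ¬ Covered g'.W g'.len e := by rwa [← h.W, ← h.len]
      by_cases hp : pick D (insert e g.buf) = ∅
      · have hp' : pick D (insert e g'.buf) = ∅ := by rwa [← h.buf]
        simp only [History.step, hp, hp', or_true, if_true]
        exact ⟨h.len, h.W,
          by rw [buf_insert_of_not_covered hc, buf_insert_of_not_covered hc', h.buf],
          h.del, h.orig, hins⟩
      · have hp' : ¬ pick D (insert e g'.buf) = ∅ := by rwa [← h.buf]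
        simp only [History.step, hc, hc', hp, hp', or_self, if_false]
        refine ⟨by simp only [h.len], by simp only [h.len, h.W, h.buf], ?_, h.del, ?_, ?_⟩
        · rw [buf_new_cluster g e _ _ hc, buf_new_cluster g' e _ _ hc', h.buf]
        · dsimp only
          rw [sample_union, sample_union, ← h.buf]
          exact trunc_union_congr h.orig _
        · intro j v i hi k hk
          dsimp only
          rw [← h.buf, ← h.len]
          rcases lt_trichotomy j g.len with hj | rfl | hj
          · have := hins j v i hi k hk
            unfold DynamicSpanner.sketch at this ⊢
            rwa [clusterStar_update_of_lt _ _ hj, clusterStar_update_of_lt _ _ hj]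
          · unfold DynamicSpanner.sketch
            rw [clusterStar_update_self, clusterStar_update_self, filter_eq_insert_buf hc, h.len,
              filter_eq_insert_buf hc', h.buf]
          · have h1 : ∀ S, Function.update g.W g.len S j = ∅ := fun S => by
              rw [Function.update_of_ne hj.ne']
              exact hg.W_eq_empty j hj.le
            have h2 : ∀ S, Function.update g'.W g.len S j = ∅ := fun S => by
              rw [Function.update_of_ne hj.ne', ← h.W]
              exact hg.W_eq_empty j hj.le
            unfold DynamicSpanner.sketch
            rw [clusterStar_eq_empty _ (by rw [h1]; exact notMem_empty v),
              clusterStar_eq_empty _ (by rw [h2]; exact notMem_empty v)]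
  | delete e =>
    refine ⟨h.len, h.W, ?_, ?_, h.orig, ?_⟩
    · have h1 : ∀ g : History n, (g.step D (.delete e)).buf = g.buf.erase e := by
        intro g
        exact Finset.filter_erase _ e g.cur
      rw [h1, h1, h.buf]
    · simp only [History.step, h.del]
    · intro j v i hi k hk
      simp only [History.step]
      rw [sketch_erase _ _ _ hu, sketch_erase _ _ _ hu', h.sketch j v i hi k hk, h.W]

/-- The edges that can be read off from the memory content: the buffer, the surviving sampled
cluster edges, and all recoverable samples of stars. -/
def History.outEdges (ω : Sym2 (Fin n) → Fin (2 ^ l)) (i₀ q L s : ℕ) (g : History n) :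
    Set (Sym2 (Fin n)) :=
  {e | e ∈ g.buf ∨ (∃ Y ∈ trunc q (sample ω i₀ g.orig), e ∈ Y \ g.del) ∨
    ∃ j v, ∃ i ≤ L, #(sample ω i (clusterStar g.W g.cur j v)) ≤ s ∧
      e ∈ sample ω i (clusterStar g.W g.cur j v)}

lemma Agree.symm {φ : Sym2 (Fin n) → ZMod p} {ω : Sym2 (Fin n) → Fin (2 ^ l)}
    {i₀ q L s : ℕ} {g g' : History n} (h : Agree φ ω i₀ q L s g g') :
    Agree φ ω i₀ q L s g' g :=
  ⟨h.len.symm, h.W.symm, h.buf.symm, h.del.symm, h.orig.symm,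
    fun j v i hi k hk => (h.sketch j v i hi k hk).symm⟩

lemma Agree.outEdges_eq [Fact p.Prime] {φ : Sym2 (Fin n) → ZMod p}
    (hφ : Function.Injective φ) (hp : Fintype.card (Sym2 (Fin n)) < p)
    {ω : Sym2 (Fin n) → Fin (2 ^ l)} {i₀ q L s : ℕ} (hs : 0 < s) {g g' : History n}
    (h : Agree φ ω i₀ q L s g g') : g.outEdges ω i₀ q L s = g'.outEdges ω i₀ q L s := by
  have key : ∀ {g g' : History n}, Agree φ ω i₀ q L s g g' →
      g.outEdges ω i₀ q L s ⊆ g'.outEdges ω i₀ q L s := by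
    intro g g' h e he
    rcases he with he | ⟨Y, hY, heY⟩ | ⟨j, v, i, hi, hcard, he⟩
    · exact Or.inl (h.buf ▸ he)
    · exact Or.inr (Or.inl ⟨Y, h.orig ▸ hY, h.del ▸ heY⟩)
    · have := eq_of_powerSum_eq hφ hp hs hcard (h.sketch j v i hi)
      rw [this] at hcard he
      exact Or.inr (Or.inr ⟨j, v, i, hi, hcard, he⟩)
  exact Set.Subset.antisymm (key h) (key h.symm)

/-- All bad events of a cluster `W` and a vertex: the sampled cluster edges fail to expand, no level
of the star `A` reveals an edge of `A'`, or there are too many sampled cluster edges. -/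
def IsBad (c : ℝ) (D i₀ q L s : ℕ) (d : Finset (Fin n) × Finset (Sym2 (Fin n)) ×
    Finset (Sym2 (Fin n)) × Finset (Sym2 (Fin n)) × Finset (Sym2 (Fin n)) × Finset (Sym2 (Fin n)))
    (ω : Sym2 (Fin n) → Fin (2 ^ l)) : Prop :=
  match d with
  | (W, E, F, A, A', O) =>
    (IsMinDense D E W ∧ 8 * #(W \ light D F W) ≤ D ∧ ¬ GoodExpansion c D i₀ W E F ω) ∨
    (s < #A ∧ #A ≤ n ∧ #A ≤ 2 * #A' ∧ ¬ GoodLevel s L A A' ω) ∨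
    q < #(sample ω i₀ O)

open Classical in
/-- The data for `IsBad` that belong to the cluster `j` and the vertex `v`. -/
noncomputable def History.data (D : ℕ) (g : History n) (x : ℕ × Fin n) :
    Finset (Fin n) × Finset (Sym2 (Fin n)) × Finset (Sym2 (Fin n)) × Finset (Sym2 (Fin n)) ×
      Finset (Sym2 (Fin n)) × Finset (Sym2 (Fin n)) :=
  (g.W x.1, if h : ∃ E ⊆ g.orig, IsMinDense D E (g.W x.1) then h.choose else ∅, g.del,
    clusterStar g.W g.cur x.1 x.2,
    (clusterStar g.W g.cur x.1 x.2).filter fun e => ∃ w ∈ light D g.del (g.W x.1), e = s(x.2, w),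
    g.orig)

lemma card_clusterStar_le (W : ℕ → Finset (Fin n)) (C : Finset (Sym2 (Fin n))) (j : ℕ)
    (v : Fin n) : #(clusterStar W C j v) ≤ n := by
  have : clusterStar W C j v ⊆ (univ : Finset (Fin n)).image fun w => s(v, w) := by
    intro e he
    obtain ⟨w, rfl⟩ := Sym2.mem_iff_exists.1 (mem_clusterStar.1 he).2.2
    exact mem_image_of_mem _ (mem_univ w)
  exact (card_le_card this).trans (card_image_le.trans (by simp))

/-- Without bad events, the output is a spanner. Each end of an edge inside a cluster is lightly
damaged, or has few cluster edges, which are all recovered, or has a recovered edge to a lightly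
damaged vertex; and the sampled cluster edges connect lightly damaged vertices by short paths. -/
theorem isSpanner_outEdges (hn : 3 ≤ n) {c : ℝ} (hc : 0 < c) {D f i₀ q L s : ℕ} (hD : 2 ≤ D)
    (hDf : 128 * f ≤ D * D) (hs : 2 * (16 * f / D) ≤ s) {ω : Sym2 (Fin n) → Fin (2 ^ l)}
    {g : History n} (hg : g.Valid D) (hdel : #g.del ≤ f)
    (hgood : ∀ j < g.len, ∀ v, ¬ IsBad c D i₀ q L s (g.data D (j, v)) ω) :
    IsSpanner (30000 * (Real.log n * Real.log (Real.log n)))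
      (SimpleGraph.fromEdgeSet (g.cur : Set (Sym2 (Fin n))))
      (SimpleGraph.fromEdgeSet (g.outEdges ω i₀ q L s)) := by
  classical
  have hrad := radius_le hn
  have ht : (0 : ℝ) < ((2 * radius n + 2 : ℕ) : ℝ) := by positivity
  refine isSpanner_of_adj (k := 2 * radius n + 2) (ht.trans_le hrad) hrad ?_ ?_
  · refine SimpleGraph.fromEdgeSet_mono ?_
    rintro e (he | ⟨Y, hY, heY⟩ | ⟨j, v, i, hi, hcard, he⟩)
    · exact (mem_filter.1 he).1
    · rw [trunc] at hY
      split_ifs at hY with h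
      · rw [Option.mem_some_iff] at hY
        subst hY
        rw [mem_sdiff] at heY
        exact hg.orig_sdiff_del_subset (mem_sdiff.2 ⟨sample_subset _ _ _ heY.1, heY.2⟩)
      · simp at hY
    · exact (mem_clusterStar.1 (sample_subset _ _ _ he)).1
  · intro u v huv
    rw [SimpleGraph.fromEdgeSet_adj] at huv
    have hone : ∀ {x y : Fin n}, s(x, y) ∈ g.outEdges ω i₀ q L s →
        (SimpleGraph.fromEdgeSet (g.outEdges ω i₀ q L s)).edist x y ≤ 1 :=
      fun h => edist_le_one_of_mem h
    by_cases hout : s(u, v) ∈ g.outEdges ω i₀ q L s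
    · refine (hone hout).trans ?_
      exact_mod_cast Nat.succ_le_succ (Nat.zero_le _)
    have hcov : Covered g.W g.len s(u, v) := by
      by_contra hcov
      exact hout (Or.inl (mem_filter.2 ⟨by exact_mod_cast huv.1, hcov⟩))
    obtain ⟨j, hj, hown⟩ := hcov.exists_owns
    set H := light D g.del (g.W j) with hH
    have hheavy : #(g.W j \ H) * D ≤ 16 * f :=
      (card_sdiff_light_mul_le D g.del (g.W j)).trans (by omega)
    have hheavy1 : 8 * #(g.W j \ H) ≤ D := by
      by_contra hc
      have : D * D < 8 * #(g.W j \ H) * D := Nat.mul_lt_mul_of_pos_right (not_le.1 hc) (by omega)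
      nlinarith
    have hheavy2 : 2 * #(g.W j \ H) ≤ s := by
      have := (Nat.le_div_iff_mul_le (by omega : 0 < D)).2 hheavy
      omega
    -- the ends of the edge are close to lightly damaged vertices
    have hend : ∀ x ∈ s(u, v), ∃ y ∈ H,
        (SimpleGraph.fromEdgeSet (g.outEdges ω i₀ q L s)).edist x y ≤ 1 := by
      intro x hx
      by_cases hxH : x ∈ H
      · exact ⟨x, hxH, by simp⟩
      set A := clusterStar g.W g.cur j x with hA
      have heA : s(u, v) ∈ A := mem_clusterStar.2 ⟨by exact_mod_cast huv.1, hown, hx⟩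
      have hsA : s < #A := by
        by_contra hsA
        refine hout (Or.inr (Or.inr ⟨j, x, 0, Nat.zero_le _, ?_, ?_⟩))
        · rw [sample_zero]
          exact not_lt.1 hsA
        · rwa [sample_zero]
      have hAA' : #A ≤ 2 * #(A.filter fun e => ∃ w ∈ H, e = s(x, w)) := by
        have h1 : A ⊆ (A.filter fun e => ∃ w ∈ H, e = s(x, w)) ∪
            (g.W j \ H).image fun w => s(x, w) := by
          intro e he
          obtain ⟨_, ho, hxe⟩ := mem_clusterStar.1 he
          obtain ⟨w, rfl⟩ := Sym2.mem_iff_exists.1 hxe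
          have hw : w ∈ g.W j := mem_sym2_iff.1 ho.1 w (Sym2.mem_mk_right x w)
          by_cases hwH : w ∈ H
          · exact mem_union_left _ (mem_filter.2 ⟨he, w, hwH, rfl⟩)
          · exact mem_union_right _ (mem_image_of_mem _ (mem_sdiff.2 ⟨hw, hwH⟩))
        have h2 := (card_le_card h1).trans (card_union_le _ _)
        have h3 : #((g.W j \ H).image fun w => s(x, w)) ≤ #(g.W j \ H) := card_image_le
        omega
      have hlev : GoodLevel s L A (A.filter fun e => ∃ w ∈ H, e = s(x, w)) ω := by
        by_contra hlev
        exact hgood j hj x (Or.inr (Or.inl ⟨hsA, card_clusterStar_le _ _ _ _, hAA', hlev⟩))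
      obtain ⟨i, hi, ⟨e, he⟩, hcard⟩ := hlev
      obtain ⟨heA', hω⟩ := mem_filter.1 he
      obtain ⟨heA, w, hw, rfl⟩ := mem_filter.1 heA'
      exact ⟨w, hw, hone (Or.inr (Or.inr ⟨j, x, i, hi, hcard, mem_filter.2 ⟨heA, hω⟩⟩))⟩
    have hex := hg.exists_minDense j hj
    obtain ⟨hEo, hmin⟩ := hex.choose_spec
    set E := hex.choose with hE
    have hexp : GoodExpansion c D i₀ (g.W j) E g.del ω := by
      by_contra hexp
      refine hgood j hj u (Or.inl ⟨?_, hheavy1, ?_⟩)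
      · dsimp only
        rw [dif_pos hex]
        exact hmin
      · dsimp only
        rw [dif_pos hex]
        exact hexp
    have hq : #(sample ω i₀ g.orig) ≤ q := by
      by_contra hq
      exact hgood j hj u (Or.inr (Or.inr (not_le.1 hq)))
    have hsub : ((sample ω i₀ E \ g.del : Finset (Sym2 (Fin n))) : Set (Sym2 (Fin n))) ⊆
        g.outEdges ω i₀ q L s := by
      intro e he
      rw [mem_coe, mem_sdiff] at he
      refine Or.inr (Or.inl ⟨sample ω i₀ g.orig, ?_, mem_sdiff.2 ⟨?_, he.2⟩⟩)
      · rw [trunc, if_pos hq]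
        rfl
      · exact filter_subset_filter _ hEo he.1
    obtain ⟨y, hy, hxy⟩ := hend u (Sym2.mem_mk_left u v)
    obtain ⟨z, hz, hvz⟩ := hend v (Sym2.mem_mk_right u v)
    have hyz : (SimpleGraph.fromEdgeSet (g.outEdges ω i₀ q L s)).edist y z ≤
        (2 * radius n : ℕ) := by
      refine (SimpleGraph.edist_anti (SimpleGraph.fromEdgeSet_mono hsub)).trans
        ((edist_le_of_expanding (light_subset D g.del (g.W j)) (κ := c / 8) (by positivity)
          (hmin.prop.two_le_card hD) (fun S h1 h2 h3 => (hexp S h1 h2 h3).1)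
          (fun S h1 h2 h3 => (hexp S h1 h2 h3).2) hy hz).trans ?_)
      have hWn : #(g.W j) ≤ n := by simpa using card_le_univ (g.W j)
      have := radius_mono (a := #(g.W j)) (b := n) (by exact_mod_cast hmin.prop.1.card_pos)
        (by exact_mod_cast hWn)
      exact_mod_cast Nat.mul_le_mul_left 2 this
    rw [SimpleGraph.edist_comm] at hvz
    calc _ ≤ _ := SimpleGraph.edist_triangle (v := y)
      _ ≤ 1 + ((2 * radius n : ℕ) + 1) :=
        add_le_add hxy ((SimpleGraph.edist_triangle (v := z)).trans (add_le_add hyz hvz))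
      _ = ((2 * radius n + 2 : ℕ) : ℕ∞) := by
        push_cast
        ring

end Sketch

/-! ### Many deletions: the size of the memory -/

section Code

variable {n l p : ℕ}

/-- The clusters as a set of records. -/
def clusterRecords (J : ℕ) (g : History n) : Finset ((_ : Fin J) × Fin n) :=
  univ.sigma fun j => g.W j

/-- The sketches at cluster vertices as a set of records. -/
noncomputable def sketchRecords (φ : Sym2 (Fin n) → ZMod p) (ω : Sym2 (Fin n) → Fin (2 ^ l))
    (J L s : ℕ) (g : History n) :
    Finset ((((_ : Fin J) × Fin n) × (Fin (L + 1) × Fin (2 * s))) × ZMod p) :=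
  (clusterRecords J g ×ˢ univ).image fun x =>
    (x, sketch φ ω g.W g.cur x.1.1 x.1.2 x.2.1 x.2.2)

/-- The memory content after a stream with history `g`. -/
noncomputable def code (φ : Sym2 (Fin n) → ZMod p) (ω : Sym2 (Fin n) → Fin (2 ^ l))
    (J i₀ q L s : ℕ) (g : History n) :
    ℕ × Finset ((_ : Fin J) × Fin n) × Finset (Sym2 (Fin n)) × Finset (Sym2 (Fin n)) ×
      Option (Finset (Sym2 (Fin n))) ×
      Finset ((((_ : Fin J) × Fin n) × (Fin (L + 1) × Fin (2 * s))) × ZMod p) :=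
  (g.len, clusterRecords J g, g.buf, g.del, trunc q (sample ω i₀ g.orig),
    sketchRecords φ ω J L s g)

/-- The values that `code` can take, given the sizes of the parts. -/
def codes (n p J q L s M b f : ℕ) [NeZero p] :
    Finset (ℕ × Finset ((_ : Fin J) × Fin n) × Finset (Sym2 (Fin n)) × Finset (Sym2 (Fin n)) ×
      Option (Finset (Sym2 (Fin n))) ×
      Finset ((((_ : Fin J) × Fin n) × (Fin (L + 1) × Fin (2 * s))) × ZMod p)) :=
  range (J + 1) ×ˢ smallSets _ M ×ˢ smallSets _ b ×ˢ smallSets _ f ×ˢ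
    insertNone (smallSets _ q) ×ˢ smallSets _ (M * ((L + 1) * (2 * s)))

lemma card_clusterRecords {D J : ℕ} {g : History n} (hg : g.Valid D) (hJ : g.len ≤ J) :
    #(clusterRecords J g) = ∑ j ∈ range g.len, #(g.W j) := by
  rw [clusterRecords, card_sigma, Fin.sum_univ_eq_sum_range fun j => #(g.W j)]
  refine (sum_subset (range_subset_range.2 hJ) fun j _ hj => ?_).symm
  rw [hg.W_eq_empty j (by simpa using hj), card_empty]

lemma code_mem_codes [NeZero p] {D J M b f : ℕ} (φ : Sym2 (Fin n) → ZMod p)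
    (ω : Sym2 (Fin n) → Fin (2 ^ l)) (i₀ q L s : ℕ) {g : History n} (hg : g.Valid D)
    (hJ : g.len ≤ J) (hM : ∑ j ∈ range g.len, #(g.W j) ≤ M) (hb : #g.buf ≤ b)
    (hf : #g.del ≤ f) : code φ ω J i₀ q L s g ∈ codes n p J q L s M b f := by
  have hrec : #(clusterRecords J g) ≤ M := (card_clusterRecords hg hJ).trans_le hM
  simp only [code, codes, mem_product, mem_smallSets, mem_range]
  refine ⟨by omega, hrec, hb, hf, ?_, ?_⟩
  · rw [mem_insertNone]
    intro Y hY
    rw [trunc] at hY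
    split_ifs at hY with h
    · rw [Option.mem_some_iff] at hY
      rw [← hY, mem_smallSets]
      exact h
    · simp at hY
  · refine card_image_le.trans ?_
    rw [card_product, card_univ, Fintype.card_prod, Fintype.card_fin, Fintype.card_fin]
    exact Nat.mul_le_mul_right _ hrec

lemma Agree.code_eq {φ : Sym2 (Fin n) → ZMod p} {ω : Sym2 (Fin n) → Fin (2 ^ l)}
    {J i₀ q L s : ℕ} {g g' : History n} (h : Agree φ ω i₀ q L s g g') :
    code φ ω J i₀ q L s g = code φ ω J i₀ q L s g' := by
  have hrec : clusterRecords J g = clusterRecords J g' := by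
    rw [clusterRecords, clusterRecords, h.W]
  have hsk : sketchRecords φ ω J L s g = sketchRecords φ ω J L s g' := by
    rw [sketchRecords, sketchRecords, hrec]
    refine image_congr fun x _ => ?_
    rw [h.sketch x.1.1 x.1.2 x.2.1 (Nat.lt_succ_iff.1 x.2.1.2) x.2.2 x.2.2.2]
  simp only [code, h.len, hrec, h.buf, h.del, h.orig, hsk]

/-- Only the sketches at vertices of clusters are stored, as all other stars are empty. -/
lemma agree_of_code_eq {D J : ℕ} {φ : Sym2 (Fin n) → ZMod p} {ω : Sym2 (Fin n) → Fin (2 ^ l)}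
    {i₀ q L s : ℕ} {g g' : History n} (hg : g.Valid D) (hg' : g'.Valid D) (hJ : g.len ≤ J)
    (h : code φ ω J i₀ q L s g = code φ ω J i₀ q L s g') : Agree φ ω i₀ q L s g g' := by
  simp only [code, Prod.mk.injEq] at h
  obtain ⟨hlen, hrec, hbuf, hdel, horig, hsk⟩ := h
  have hW : g.W = g'.W := by
    funext j
    rcases lt_or_ge j g.len with hj | hj
    · ext v
      have : (⟨⟨j, hj.trans_le hJ⟩, v⟩ : (_ : Fin J) × Fin n) ∈ clusterRecords J g ↔
          (⟨⟨j, hj.trans_le hJ⟩, v⟩ : (_ : Fin J) × Fin n) ∈ clusterRecords J g' := by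
        rw [hrec]
      simpa [clusterRecords] using this
    · rw [hg.W_eq_empty j hj, hg'.W_eq_empty j (hlen ▸ hj)]
  refine ⟨hlen, hW, hbuf, hdel, horig, fun j v i hi k hk => ?_⟩
  by_cases hv : v ∈ g.W j
  · have hj : j < g.len := by
      by_contra hj
      rw [hg.W_eq_empty j (not_lt.1 hj)] at hv
      exact notMem_empty v hv
    set x : ((_ : Fin J) × Fin n) × (Fin (L + 1) × Fin (2 * s)) :=
      (⟨⟨j, hj.trans_le hJ⟩, v⟩, (⟨i, Nat.lt_succ_iff.2 hi⟩, ⟨k, hk⟩)) with hx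
    have h1 : (x, sketch φ ω g.W g.cur j v i k) ∈ sketchRecords φ ω J L s g := by
      refine mem_image.2 ⟨x, ?_, rfl⟩
      simp [clusterRecords, hx, hv]
    rw [hsk] at h1
    obtain ⟨y, _, hy⟩ := mem_image.1 h1
    rw [Prod.mk.injEq] at hy
    obtain ⟨rfl, hy⟩ := hy
    exact hy.symm
  · unfold sketch
    rw [clusterStar_eq_empty _ hv, clusterStar_eq_empty _ (hW ▸ hv)]

lemma card_codes_le [NeZero p] {q s M b f : ℕ} (hn : 0 < n) (hp : p ≤ 2 * (n * n))
    (hs : 2 * s ≤ 2 ^ (18 * scale n)) :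
    #(codes n p (n * n) q (scale n) s M b f) ≤ 2 ^ (2 * scale n + (3 * scale n * M +
      (2 * scale n * b + (2 * scale n * f + ((2 * scale n * q + 1) +
        26 * scale n * (M * ((scale n + 1) * (2 * s)))))))) := by
  have hlt := lt_two_pow_scale n
  have hl1 := one_le_scale n
  set a := scale n with ha
  have hE := card_sym2_add_one_le hn
  have hn2 : n * n + 1 ≤ 2 ^ (2 * a) := by
    rw [two_mul, pow_add]
    nlinarith
  have hn3 : n * n * n + 1 ≤ 2 ^ (3 * a) := by
    have h1 : n * n * n + 1 ≤ (n + 1) ^ 3 := by nlinarith [sq_nonneg n]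
    refine h1.trans ((Nat.pow_le_pow_left hlt 3).trans (le_of_eq ?_))
    rw [← pow_mul, mul_comm]
  have hJn : Fintype.card ((_ : Fin (n * n)) × Fin n) = n * n * n := by simp
  have ha2 : a + 1 ≤ 2 ^ a := Nat.lt_two_pow_self
  have hrec : Fintype.card ((((_ : Fin (n * n)) × Fin n) × (Fin (a + 1) × Fin (2 * s))) × ZMod p)
      + 1 ≤ 2 ^ (26 * a) := by
    rw [Fintype.card_prod, Fintype.card_prod, hJn, Fintype.card_prod, Fintype.card_fin,
      Fintype.card_fin, ZMod.card]
    have h1 : n * n * n * ((a + 1) * (2 * s)) ≤ (2 ^ (3 * a) - 1) * (2 ^ a * 2 ^ (18 * a)) :=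
      Nat.mul_le_mul (by omega) (Nat.mul_le_mul ha2 hs)
    have h2 : p ≤ 2 ^ (3 * a) := by
      have : 2 ^ (3 * a) = 2 ^ a * 2 ^ (2 * a) := by
        rw [← pow_add]
        congr 1
        omega
      have h3 : 2 ≤ 2 ^ a := by
        calc 2 = 2 ^ 1 := rfl
          _ ≤ 2 ^ a := Nat.pow_le_pow_right (by norm_num) hl1
      rw [this]
      exact hp.trans (Nat.mul_le_mul h3 (by omega))
    have h3 : n * n * n * ((a + 1) * (2 * s)) * p ≤
        (2 ^ (3 * a) - 1) * (2 ^ a * 2 ^ (18 * a)) * 2 ^ (3 * a) := Nat.mul_le_mul h1 h2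
    have h4 : 2 ^ (26 * a) = 2 ^ (3 * a) * (2 ^ a * 2 ^ (18 * a)) * 2 ^ (3 * a) * 2 ^ a := by
      rw [← pow_add, ← pow_add, ← pow_add, ← pow_add]
      congr 1
      omega
    have h5 : 1 ≤ 2 ^ (3 * a) := Nat.one_le_two_pow
    have h6 : 1 ≤ 2 ^ a * 2 ^ (18 * a) * 2 ^ (3 * a) := Nat.one_le_iff_ne_zero.2 (by positivity)
    have h7 : (2 ^ (3 * a) - 1) * (2 ^ a * 2 ^ (18 * a)) * 2 ^ (3 * a) + 1 ≤
        2 ^ (3 * a) * (2 ^ a * 2 ^ (18 * a)) * 2 ^ (3 * a) := by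
      obtain ⟨y, hy⟩ : ∃ y, 2 ^ (3 * a) = y + 1 := ⟨2 ^ (3 * a) - 1, by omega⟩
      generalize 2 ^ a * 2 ^ (18 * a) = z at *
      rw [hy] at h6 ⊢
      rw [Nat.add_sub_cancel]
      nlinarith
    rw [h4]
    calc _ ≤ _ := Nat.add_le_add_right h3 1
      _ ≤ _ := h7
      _ ≤ _ := Nat.le_mul_of_pos_right _ (by positivity)
  have hq : #(insertNone (smallSets (Sym2 (Fin n)) q)) ≤ 2 ^ (2 * a * q + 1) := by
    rw [card_insertNone, pow_succ]
    have : #(smallSets (Sym2 (Fin n)) q) ≤ 2 ^ (2 * a * q) := card_smallSets_le hE q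
    have : 1 ≤ 2 ^ (2 * a * q) := Nat.one_le_two_pow
    omega
  simp only [codes, card_product, card_range]
  rw [pow_add, pow_add _ (3 * a * M), pow_add _ (2 * a * b), pow_add _ (2 * a * f),
    pow_add _ (2 * a * q + 1)]
  exact Nat.mul_le_mul hn2 (Nat.mul_le_mul (card_smallSets_le (by rw [hJn]; exact hn3) M)
    (Nat.mul_le_mul (card_smallSets_le hE b) (Nat.mul_le_mul (card_smallSets_le hE f)
      (Nat.mul_le_mul hq (card_smallSets_le hrec _)))))

end Code

/-! ### Many deletions: the algorithm -/

section ManyDeletions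

variable {n : ℕ}

lemma prob_and_const_le {Ω : Type*} [Fintype Ω] {a : Prop} {r : Ω → Prop} {x : ℝ} (hx : 0 ≤ x)
    (h : a → prob r ≤ x) : prob (fun ω => a ∧ r ω) ≤ x := by
  by_cases ha : a
  · simpa [ha] using h ha
  · simpa [ha, prob] using hx

lemma exp_neg_scale_le (hn : 0 < n) : Real.exp (-(130 * scale n)) ≤ 1 / (n : ℝ) ^ 130 := by
  have hn' : (0 : ℝ) < n := by exact_mod_cast hn
  have h1 : (n : ℝ) ≤ Real.exp (scale n) := by
    rw [← Real.log_le_iff_le_exp hn']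
    exact log_le_scale hn
  have h2 : (n : ℝ) ^ 130 ≤ Real.exp (130 * scale n) := by
    refine (pow_le_pow_left₀ hn'.le h1 130).trans (le_of_eq ?_)
    rw [← Real.exp_nat_mul]
    norm_num
  rw [Real.exp_neg, ← one_div]
  exact one_div_le_one_div_of_le (by positivity) h2

/-- The failure probability is far below `n ^ (-100)`, to leave room for the union bound over
clusters and vertices and for the loss in passing to few seeds. The constants `2080` and
`8320` make the exponents in `prob_not_goodExpansion_le` and `prob_not_goodLevel_le` equal to
`130 * scale n`. -/
lemma prob_isBad_le (hn : 3 ≤ n) {l i₀ D q s : ℕ} (hi₀ : i₀ ≤ l) (hl : scale n ≤ l)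
    (hD : D = 2 ^ i₀ * (2080 * scale n)) (hs : 8320 * scale n ≤ s)
    (hq : 2 * (n * n / 2 ^ i₀ + 1) + 130 * scale n ≤ q)
    (d : Finset (Fin n) × Finset (Sym2 (Fin n)) × Finset (Sym2 (Fin n)) ×
      Finset (Sym2 (Fin n)) × Finset (Sym2 (Fin n)) × Finset (Sym2 (Fin n))) :
    prob (fun ω : Sym2 (Fin n) → Fin (2 ^ l) =>
      IsBad (2080 * scale n) D i₀ q (scale n) s d ω) ≤ 1 / ((n ^ 120 : ℕ) : ℝ) := by
  obtain ⟨W, E, F, A, A', O⟩ := d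
  have hn0 : 0 < n := by omega
  have hn' : (3 : ℝ) ≤ n := by exact_mod_cast hn
  have hsc : (1 : ℝ) ≤ scale n := by exact_mod_cast one_le_scale n
  set x : ℝ := 1 / (n : ℝ) ^ 130 with hx
  have hx0 : 0 < x := by positivity
  have hexp : Real.exp (-(130 * scale n)) ≤ x := exp_neg_scale_le hn0
  have hnx : (n : ℝ) * x = 1 / (n : ℝ) ^ 129 := by
    rw [hx]
    field_simp
  have h129 : (1 : ℝ) ≤ (n : ℝ) ^ 129 := one_le_pow₀ (by linarith)
  have h1 : prob (fun ω : Sym2 (Fin n) → Fin (2 ^ l) => IsMinDense D E W ∧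
      8 * #(W \ light D F W) ≤ D ∧ ¬ GoodExpansion (2080 * scale n) D i₀ W E F ω) ≤
      4 * (n * x) := by
    refine prob_and_const_le (by positivity) fun hW => ?_
    refine prob_and_const_le (by positivity) fun hheavy => ?_
    have := prob_not_goodExpansion_le (l := l) (c := 2080 * scale n) (x := x) hi₀ (by positivity)
      (by rw [hD]; push_cast; ring) hW hheavy
      (by refine le_trans (le_of_eq ?_) hexp; congr 1; ring)
      (by
        rw [Fintype.card_fin, hnx, div_le_one (by positivity)]
        exact h129)
    rwa [Fintype.card_fin] at this
  have h2 : prob (fun ω : Sym2 (Fin n) → Fin (2 ^ l) => s < #A ∧ #A ≤ n ∧ #A ≤ 2 * #A' ∧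
      ¬ GoodLevel s (scale n) A A' ω) ≤ 2 * x := by
    refine prob_and_const_le (by positivity) fun hsA => ?_
    refine prob_and_const_le (by positivity) fun hAn => ?_
    refine prob_and_const_le (by positivity) fun hAA' => ?_
    refine (prob_not_goodLevel_le hl (by have := one_le_scale n; omega) hsA
      (hAn.trans (lt_two_pow_scale n).le) hAA').trans ?_
    refine mul_le_mul_of_nonneg_left (le_trans (Real.exp_le_exp.2 ?_) hexp) (by norm_num)
    have : (8320 : ℝ) * scale n ≤ s := by exact_mod_cast hs
    linarith
  have h3 : prob (fun ω : Sym2 (Fin n) → Fin (2 ^ l) => q < #(sample ω i₀ O)) ≤ x := by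
    refine (prob_mono (q := fun ω => (q : ℝ) ≤ #(sample ω i₀ O)) fun ω hω => ?_).trans
      ((prob_le_card_sample i₀ hi₀ O q).trans (le_trans (Real.exp_le_exp.2 ?_) hexp))
    · exact_mod_cast hω.le
    · have h4 : (#O : ℝ) / 2 ^ i₀ ≤ (n * n / 2 ^ i₀ + 1 : ℕ) := by
        have h5 : #O ≤ n * n := (card_le_univ O).trans (card_sym2_le hn0)
        have h6 : n * n < (n * n / 2 ^ i₀ + 1) * 2 ^ i₀ := by
          rw [mul_comm (_ + 1)]
          exact Nat.lt_mul_div_succ _ (Nat.two_pow_pos i₀)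
        rw [div_le_iff₀ (by positivity)]
        exact_mod_cast h5.trans h6.le
      have h7 : (2 : ℝ) * (n * n / 2 ^ i₀ + 1 : ℕ) + 130 * scale n ≤ q := by exact_mod_cast hq
      linarith
  have hsum : prob (fun ω : Sym2 (Fin n) → Fin (2 ^ l) =>
      IsBad (2080 * scale n) D i₀ q (scale n) s (W, E, F, A, A', O) ω) ≤
      4 * (n * x) + (2 * x + x) :=
    (prob_or_le _ _).trans (add_le_add h1 ((prob_or_le _ _).trans (add_le_add h2 h3)))
  refine hsum.trans ?_
  have h4 : x ≤ n * x := le_mul_of_one_le_left hx0.le (by linarith)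
  have h5 : (7 : ℝ) * (n * x) ≤ 1 / ((n ^ 120 : ℕ) : ℝ) := by
    rw [hnx]
    push_cast
    rw [mul_one_div, div_le_div_iff₀ (by positivity) (by positivity), one_mul]
    have h7 : (7 : ℝ) ≤ (n : ℝ) ^ 9 :=
      (by norm_num : (7 : ℝ) ≤ 3 ^ 9).trans (pow_le_pow_left₀ (by norm_num) hn' 9)
    rw [show (129 : ℕ) = 9 + 120 from rfl, pow_add]
    exact mul_le_mul_of_nonneg_right h7 (by positivity)
  linarith

/-- The space of the algorithm for many deletions, in terms of the sampling level `i₀`. -/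
def manySpace (n f i₀ : ℕ) : ℕ :=
  let D := 2 ^ i₀ * (2080 * scale n)
  124 * scale n + (2 * scale n + (3 * scale n * (n * n / D) +
    (2 * scale n * (D * n * (2 * scale n)) + (2 * scale n * f +
      ((2 * scale n * (2 * (n * n / 2 ^ i₀ + 1) + 130 * scale n) + 1) +
        26 * scale n * (n * n / D * ((scale n + 1) *
          (2 * (2 * (16 * f / D) + 8320 * scale n)))))))))

lemma two_mul_capacity_le (hn : 0 < n) {f D : ℕ} (hf : f ≤ n * n) :
    2 * (2 * (16 * f / D) + 8320 * scale n) ≤ 2 ^ (18 * scale n) := by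
  have h1 : 16 * f / D ≤ 16 * (n * n) := (Nat.div_le_self _ _).trans (by omega)
  have h2 := lt_two_pow_scale n
  have h3 : scale n < 2 ^ scale n := Nat.lt_two_pow_self
  have h4 : 2 ^ (18 * scale n) = 2 ^ (16 * scale n) * (2 ^ scale n * 2 ^ scale n) := by
    rw [← pow_add, ← pow_add]
    congr 1
    omega
  have h5 : 2 ^ 16 ≤ 2 ^ (16 * scale n) :=
    Nat.pow_le_pow_right (by norm_num) (by have := one_le_scale n; omega)
  have h6 : n * n ≤ 2 ^ scale n * 2 ^ scale n := Nat.mul_le_mul h2.le h2.le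
  have h7 : 2 ^ scale n ≤ 2 ^ scale n * 2 ^ scale n := Nat.le_mul_of_pos_left _ (by positivity)
  rw [h4]
  calc 2 * (2 * (16 * f / D) + 8320 * scale n)
      ≤ 2 ^ 16 * (2 ^ scale n * 2 ^ scale n) := by omega
    _ ≤ _ := Nat.mul_le_mul_right _ h5

lemma card_data_le (hn : 0 < n) : Fintype.card (Finset (Fin n) × Finset (Sym2 (Fin n)) ×
    Finset (Sym2 (Fin n)) × Finset (Sym2 (Fin n)) × Finset (Sym2 (Fin n)) ×
      Finset (Sym2 (Fin n))) ≤ 2 ^ (6 * (n * n)) := by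
  simp only [Fintype.card_prod, Fintype.card_finset, Fintype.card_fin, ← pow_add]
  refine Nat.pow_le_pow_right (by norm_num) ?_
  have := card_sym2_le hn
  nlinarith

/-- The seed is the index of one of polynomially many labellings, and the code of a stream is the
`code` of its history. -/
theorem exists_algorithm_many_deletions (hn : 3 ≤ n) {f i₀ : ℕ} (hf : f ≤ n * n)
    (hi₀ : f ≤ 2 ^ i₀ * 2 ^ i₀) :
    ∃ A : StreamingAlgorithm n (manySpace n f i₀),
      ∀ σ, IsAdmissible f σ → ENNReal.ofReal (1 - 1 / (n : ℝ) ^ 100) ≤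
        (A.outputLaw σ).toOuterMeasure
          {H | IsSpanner (30000 * (Real.log n * Real.log (Real.log n))) (streamGraph σ) H} := by
  classical
  have hn0 : 0 < n := by omega
  have hsc := one_le_scale n
  set D := 2 ^ i₀ * (2080 * scale n) with hD
  set s := 2 * (16 * f / D) + 8320 * scale n with hs
  set q := 2 * (n * n / 2 ^ i₀ + 1) + 130 * scale n with hq
  set l := scale n + i₀ with hl
  have hD2 : 2 ≤ D := by
    have : 1 ≤ 2 ^ i₀ := Nat.one_le_two_pow
    nlinarith
  have hDf : 128 * f ≤ D * D := by
    have h1 : 1 ≤ scale n * scale n := Nat.mul_pos hsc hsc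
    calc 128 * f ≤ 128 * (2 ^ i₀ * 2 ^ i₀) := by omega
      _ ≤ 2080 * 2080 * (2 ^ i₀ * 2 ^ i₀) * (scale n * scale n) := by nlinarith
      _ = D * D := by rw [hD]; ring
  have hcard0 : Fintype.card (Sym2 (Fin n)) ≠ 0 := by
    have : Nonempty (Sym2 (Fin n)) := ⟨s(⟨0, hn0⟩, ⟨0, hn0⟩)⟩
    exact Fintype.card_ne_zero
  obtain ⟨p, hp, hcp, hp2⟩ := Nat.exists_prime_lt_and_le_two_mul _ hcard0
  have : Fact p.Prime := ⟨hp⟩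
  obtain ⟨φ, hφ⟩ : ∃ φ : Sym2 (Fin n) → ZMod p, Function.Injective φ := by
    have : Nonempty (Sym2 (Fin n) ↪ ZMod p) := by
      apply Function.Embedding.nonempty_of_card_le
      rw [ZMod.card]
      exact hcp.le
    exact ⟨this.some, this.some.injective⟩
  -- public randomness is replaced by few seeds
  obtain ⟨N, hN⟩ : ∃ N, N = n ^ 120 * (6 * (n * n) + 1) := ⟨_, rfl⟩
  obtain ⟨seed, hseed⟩ : ∃ seed : Fin N → Sym2 (Fin n) → Fin (2 ^ l), ∀ d,
      (Nat.card {i // IsBad (2080 * scale n) D i₀ q (scale n) s d (seed i)} : ℝ) ≤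
        3 * ((6 * (n * n) : ℕ) + 1) := by
    subst hN
    exact exists_seeds (fun d ω => IsBad (2080 * scale n) D i₀ q (scale n) s d ω)
      (by positivity) (card_data_le hn0)
      (prob_isBad_le hn (by omega) (by omega) hD (by omega) le_rfl)
  have hNpos : 0 < N := by
    rw [hN]
    positivity
  have hNle : N ≤ 2 ^ (124 * scale n) := by
    have h1 : 6 * (n * n) + 1 ≤ n ^ 4 := by
      have h2 : 9 * (n * n) ≤ n ^ 4 := by
        have : n ^ 4 = n * n * (n * n) := by ring
        rw [this]
        exact Nat.mul_le_mul_right _ (by nlinarith)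
      nlinarith
    calc N ≤ n ^ 120 * n ^ 4 := hN.trans_le (Nat.mul_le_mul_left _ h1)
      _ = n ^ 124 := by rw [← pow_add]
      _ ≤ (2 ^ scale n) ^ 124 := Nat.pow_le_pow_left (lt_two_pow_scale n).le _
      _ = 2 ^ (124 * scale n) := by rw [← pow_mul, mul_comm]
  have hvalid : ∀ σ : List (EdgeUpdate n), (history D σ).Valid D := fun σ =>
    valid_history (by omega) σ
  have horig : ∀ σ : List (EdgeUpdate n), D * ∑ j ∈ range (history D σ).len,
      #((history D σ).W j) ≤ n * n := fun σ =>
    (hvalid σ).card_le.trans ((card_le_univ _).trans (card_sym2_le hn0))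
  have hlen : ∀ σ : List (EdgeUpdate n), (history D σ).len ≤ n * n := fun σ =>
    (hvalid σ).len_le.trans ((Nat.le_mul_of_pos_left _ (by omega)).trans (horig σ))
  obtain ⟨A, hA⟩ := exists_streamingAlgorithm (n := n) (N := N) (s := manySpace n f i₀) hNpos
    (codes n p (n * n) q (scale n) s (n * n / D) (D * n * (2 * scale n)) f)
    (by
      rw [manySpace, pow_add]
      exact Nat.mul_le_mul hNle (card_codes_le hn0
        (hp2.trans (Nat.mul_le_mul_left 2 (card_sym2_le hn0))) (two_mul_capacity_le hn0 hf)))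
    (IsAdmissible f) (fun σ u h => h.of_append)
    (fun i σ => code φ (seed i) (n * n) i₀ q (scale n) s (history D σ))
    (fun i σ hσ => code_mem_codes φ (seed i) i₀ q (scale n) s (hvalid σ) (hlen σ)
      ((Nat.le_div_iff_mul_le (by omega)).2 (by rw [mul_comm]; exact horig σ))
      (card_le_of_not_isDense hn0 (hvalid σ).not_isDense)
      ((card_del_history_le σ).trans hσ.2))
    (fun i σ σ' u h h' heq => by
      have hag := agree_of_code_eq (hvalid σ) (hvalid σ') (hlen σ) heq
      rw [history_append, history_append]
      refine (hag.step (hvalid σ) ?_ ?_).code_eq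
      · rw [cur_history]
        exact (isValidStream_append.1 h.1).2
      · rw [cur_history]
        exact (isValidStream_append.1 h'.1).2)
    (fun i σ => SimpleGraph.fromEdgeSet ((history D σ).outEdges (seed i) i₀ q (scale n) s))
    (fun i σ σ' _ _ heq => by
      rw [(agree_of_code_eq (hvalid σ) (hvalid σ') (hlen σ) heq).outEdges_eq hφ hcp (by omega)])
  refine ⟨A, fun σ hσ => hA σ hσ _ _ ?_⟩
  set g := history D σ with hg
  set P := {H | IsSpanner (30000 * (Real.log n * Real.log (Real.log n))) (streamGraph σ) H}
  have hsub : ({i : Fin N | SimpleGraph.fromEdgeSet (g.outEdges (seed i) i₀ q (scale n) s) ∉ P} :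
      Finset (Fin N)) ⊆ (range (n * n) ×ˢ (univ : Finset (Fin n))).biUnion fun x =>
        {i | IsBad (2080 * scale n) D i₀ q (scale n) s (g.data D x) (seed i)} := by
    intro i hi
    by_contra hc
    refine (mem_filter.1 hi).2 ?_
    have := isSpanner_outEdges hn (c := 2080 * scale n) (by positivity) hD2 hDf
      (by omega : 2 * (16 * f / D) ≤ s) (ω := seed i) (q := q) (L := scale n) (i₀ := i₀)
      (hvalid σ) ((card_del_history_le σ).trans hσ.2) fun j hj v hbad => by
        refine hc (mem_biUnion.2 ⟨(j, v), ?_, mem_filter.2 ⟨mem_univ i, hbad⟩⟩)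
        exact mem_product.2 ⟨mem_range.2 (hj.trans_le (hlen σ)), mem_univ v⟩
    rwa [cur_history] at this
  have hcount := (card_le_card hsub).trans card_biUnion_le
  have hreal : ((∑ x ∈ range (n * n) ×ˢ (univ : Finset (Fin n)),
      #{i | IsBad (2080 * scale n) D i₀ q (scale n) s (g.data D x) (seed i)} : ℕ) : ℝ) ≤
      n * n * n * (3 * ((6 * (n * n) : ℕ) + 1)) := by
    push_cast
    refine (sum_le_card_nsmul _ _ (3 * (((6 * (n * n) : ℕ) : ℝ) + 1)) fun x _ => ?_).trans ?_
    · have := hseed (g.data D x)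
      rwa [Nat.card_eq_fintype_card, Fintype.card_subtype] at this
    · rw [card_product, card_range, card_univ, Fintype.card_fin, nsmul_eq_mul]
      push_cast
      exact le_rfl
  rw [Nat.card_eq_fintype_card, Fintype.card_subtype]
  refine le_trans (by exact_mod_cast hcount) (hreal.trans ?_)
  have hn' : (3 : ℝ) ≤ n := by exact_mod_cast hn
  rw [hN]
  push_cast
  rw [one_div, ← mul_assoc _ ((n : ℝ) ^ 120)]
  have h1 : ((n : ℝ) ^ 100)⁻¹ * (n : ℝ) ^ 120 = n ^ 20 := by
    rw [show (n : ℝ) ^ 120 = n ^ 100 * n ^ 20 by rw [← pow_add], inv_mul_cancel_left₀]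
    positivity
  rw [h1]
  have h2 : (n : ℝ) * n * n * 3 ≤ n ^ 20 := by
    calc (n : ℝ) * n * n * 3 ≤ n * n * n * n := by gcongr
      _ = n ^ 4 := by ring
      _ ≤ n ^ 20 := pow_le_pow_right₀ (by linarith) (by norm_num)
  rw [← mul_assoc]
  gcongr

end ManyDeletions

/-! ### Space bounds -/

section Space

/-- The arithmetic behind `manySpace_le`, over the reals. -/
lemma space_terms_le {a A X Z Q E f : ℝ} (ha : 1 ≤ a) (hA : 1 ≤ A)
    (hXA : X ≤ A) (hXZ : X * Z ≤ 16 * A) (hQ : Q ≤ A) (hE : E ≤ 4160 * a * A) (hf : f ≤ A) :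
    124 * a + (2 * a + (3 * a * X + (2 * a * (E * (2 * a)) +
      (2 * a * f + ((2 * a * (2 * (Q + 1) + 130 * a) + 1) +
        26 * a * (X * ((a + 1) * (2 * (2 * Z + 8320 * a))))))))) ≤ 900000 * (a ^ 3 * A) := by
  have ha0 : 0 ≤ a := by linarith
  have hA0 : 0 ≤ A := by linarith
  have haa : a ≤ a ^ 2 := le_self_pow₀ ha (by norm_num)
  have haaa : a ^ 2 ≤ a ^ 3 := pow_le_pow_right₀ ha (by norm_num)
  have h1a : 1 ≤ a ^ 3 := one_le_pow₀ ha
  have ha3A : a ^ 3 ≤ a ^ 3 * A := le_mul_of_one_le_right (by positivity) hA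
  have haA : a * A ≤ a ^ 3 * A := mul_le_mul_of_nonneg_right (haa.trans haaa) hA0
  have h1 : a * X ≤ a ^ 3 * A := (mul_le_mul_of_nonneg_left hXA ha0).trans haA
  have h2 : a ^ 2 * E ≤ 4160 * (a ^ 3 * A) := by
    refine (mul_le_mul_of_nonneg_left hE (by positivity)).trans_eq ?_
    ring
  have h3 : a * f ≤ a ^ 3 * A := (mul_le_mul_of_nonneg_left hf ha0).trans haA
  have h4 : a * Q ≤ a ^ 3 * A := (mul_le_mul_of_nonneg_left hQ ha0).trans haA
  have h5 : (a ^ 2 + a) * (X * Z) ≤ 2 * a ^ 3 * (16 * A) :=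
    (mul_le_mul_of_nonneg_left hXZ (by positivity)).trans
      (mul_le_mul_of_nonneg_right (by linarith) (by positivity))
  have h6 : (a ^ 3 + a ^ 2) * X ≤ 2 * a ^ 3 * A :=
    (mul_le_mul_of_nonneg_left hXA (by positivity)).trans
      (mul_le_mul_of_nonneg_right (by linarith) hA0)
  calc _ = 126 * a + 3 * (a * X) + 4 * (a ^ 2 * E) + 2 * (a * f) + 4 * (a * Q) + 4 * a +
        260 * a ^ 2 + 1 + 104 * ((a ^ 2 + a) * (X * Z)) + 432640 * ((a ^ 3 + a ^ 2) * X) := by ring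
    _ ≤ _ := by linarith

/-- With `y³ = n f`, all parts of the memory are bounded by `n y` up to logarithmic factors: the
buffer because `2 ^ i₀ ≤ 2 y`, the clusters because `n ≤ y²`, and the recoverable stars because
`n² f / y² = n y`. -/
lemma manySpace_le {n f i₀ : ℕ} {y : ℝ} (hn : 0 < n) (hy : 1 ≤ y) (hy3 : y ^ 3 = n * f)
    (hf : f ≤ n * n) (hnf : n ≤ f * f) (hlow : y ≤ 2 ^ i₀) (hupp : (2 : ℝ) ^ i₀ ≤ 2 * y) :
    (manySpace n f i₀ : ℝ) ≤ 900000 * ((scale n : ℝ) ^ 3 * (n * y)) := by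
  have hn1 : (1 : ℝ) ≤ n := by exact_mod_cast hn
  have hf' : (f : ℝ) ≤ n * n := by exact_mod_cast hf
  have hnf' : (n : ℝ) ≤ f * f := by exact_mod_cast hnf
  have hy0 : 0 < y := by linarith
  have hyn : y ≤ n := by
    refine le_of_pow_le_pow_left₀ (n := 3) (by norm_num) (by positivity) ?_
    rw [hy3]
    nlinarith
  have hny : (n : ℝ) ≤ y ^ 2 := by
    refine le_of_pow_le_pow_left₀ (n := 3) (by norm_num) (by positivity) ?_
    calc (n : ℝ) ^ 3 = (n : ℝ) ^ 2 * n := by ring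
      _ ≤ (n : ℝ) ^ 2 * (f * f) := by gcongr
      _ = ((n : ℝ) * f) ^ 2 := by ring
      _ = (y ^ 2) ^ 3 := by
        rw [← hy3]
        ring
  set a : ℝ := (scale n : ℝ) with ha
  have ha1 : 1 ≤ a := by
    rw [ha]
    exact_mod_cast one_le_scale n
  set A : ℝ := n * y with hA
  have hA1 : 1 ≤ A := by nlinarith
  have hfA : (f : ℝ) ≤ A := by
    have h1 : (n : ℝ) * f ≤ n * A := by
      rw [← hy3, hA]
      calc y ^ 3 = y * y * y := by ring
        _ ≤ n * n * y := by gcongr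
        _ = n * (n * y) := by ring
    exact le_of_mul_le_mul_left h1 (by linarith)
  set D : ℕ := 2 ^ i₀ * (2080 * scale n) with hD
  have hDr : (D : ℝ) = 2 ^ i₀ * (2080 * a) := by
    rw [hD, ha]
    push_cast
    ring
  have hDy : y ≤ D := by
    rw [hDr]
    nlinarith
  have hDu : (D : ℝ) ≤ 4160 * a * y := by
    rw [hDr]
    nlinarith
  have hD0 : (0 : ℝ) < D := by linarith
  set X : ℝ := ((n * n / D : ℕ) : ℝ) with hX
  set Z : ℝ := ((16 * f / D : ℕ) : ℝ) with hZ
  set Q : ℝ := ((n * n / 2 ^ i₀ : ℕ) : ℝ) with hQ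
  have hX0 : 0 ≤ X := by positivity
  have hZ0 : 0 ≤ Z := by positivity
  have hnn : (n : ℝ) * n / y ≤ A := by
    rw [div_le_iff₀ hy0, hA]
    nlinarith
  have hX1 : X ≤ n * n / y := by
    have h1 : X ≤ (n * n : ℕ) / (D : ℝ) := Nat.cast_div_le
    refine h1.trans ?_
    push_cast
    exact div_le_div_of_nonneg_left (by positivity) hy0 hDy
  have hQ1 : Q ≤ A := by
    have h1 : Q ≤ (n * n : ℕ) / ((2 ^ i₀ : ℕ) : ℝ) := Nat.cast_div_le
    refine h1.trans (le_trans ?_ hnn)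
    push_cast
    exact div_le_div_of_nonneg_left (by positivity) hy0 hlow
  have hZ1 : Z ≤ 16 * f / y := by
    have h1 : Z ≤ (16 * f : ℕ) / (D : ℝ) := Nat.cast_div_le
    refine h1.trans ?_
    push_cast
    exact div_le_div_of_nonneg_left (by positivity) hy0 hDy
  have hXZ : X * Z ≤ 16 * A := by
    calc X * Z ≤ (n * n / y) * (16 * f / y) := by gcongr
      _ = 16 * n * (n * f) / y ^ 2 := by
        field_simp
      _ = 16 * n * y ^ 3 / y ^ 2 := by rw [hy3]
      _ = 16 * A := by
        rw [hA]
        field_simp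
  have hXA : X ≤ A := hX1.trans hnn
  have hE : (D : ℝ) * n ≤ 4160 * a * A := by
    calc (D : ℝ) * n ≤ 4160 * a * y * n := by gcongr
      _ = 4160 * a * A := by
        rw [hA]
        ring
  refine le_of_eq_of_le ?_ (space_terms_le ha1 hA1 hXA hXZ hQ1 hE hfA)
  simp only [manySpace, ← hD]
  push_cast
  rw [← ha, ← hX, ← hZ, ← hQ]

lemma rpow_mul_rpow_eq {n : ℕ} (hn : 0 < n) {g : ℝ} (hg : 0 ≤ g) :
    (n : ℝ) ^ (4 / 3 : ℝ) * g ^ (1 / 3 : ℝ) = n * (n * g) ^ (1 / 3 : ℝ) := by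
  have hn0 : (0 : ℝ) < n := by exact_mod_cast hn
  rw [Real.mul_rpow hn0.le hg, ← mul_assoc]
  congr 1
  rw [show (4 / 3 : ℝ) = 1 + 1 / 3 by norm_num, Real.rpow_add hn0, Real.rpow_one]

/-- A power of two within a factor two of the cube root `y` of `m`. -/
lemma exists_level {m : ℕ} (hm : 1 < m) {y : ℝ} (hy : 0 ≤ y) (hy3 : y ^ 3 = m) :
    ∃ i : ℕ, m ≤ (2 ^ i) ^ 3 ∧ y ≤ 2 ^ i ∧ (2 : ℝ) ^ i ≤ 2 * y := by
  have h1 : m ≤ (2 ^ Nat.clog 8 m) ^ 3 := by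
    rw [← pow_mul, mul_comm, pow_mul]
    exact Nat.le_pow_clog (by norm_num) m
  refine ⟨Nat.clog 8 m, h1, ?_, ?_⟩
  · refine le_of_pow_le_pow_left₀ (n := 3) (by norm_num) (by positivity) ?_
    rw [hy3]
    exact_mod_cast h1
  · refine le_of_pow_le_pow_left₀ (n := 3) (by norm_num) (by positivity) ?_
    rw [mul_pow, hy3]
    have h2 := Nat.pow_pred_clog_lt_self (b := 8) (by norm_num) hm
    have h3 : 0 < Nat.clog 8 m := Nat.clog_pos (by norm_num) hm
    have h4 : (2 ^ Nat.clog 8 m) ^ 3 ≤ 2 ^ 3 * m := by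
      rw [← pow_mul, mul_comm, pow_mul]
      obtain ⟨k, hk⟩ := Nat.exists_eq_succ_of_ne_zero h3.ne'
      rw [hk] at h2 ⊢
      rw [Nat.succ_eq_add_one, pow_succ, mul_comm]
      exact Nat.mul_le_mul_left _ h2.le
    exact_mod_cast h4

/-- The two algorithms meet at `f² = n`, where both use about `n ^ (3 / 2)` bits. -/
theorem exists_algorithm {n f : ℕ} (hn : 3 ≤ n) (hf : f ≤ n.choose 2) :
    ∃ (s : ℕ) (A : StreamingAlgorithm n s),
      (s : ℝ) ≤ 24300000 * ((n : ℝ) ^ (4 / 3 : ℝ) * (max (f : ℝ) 1) ^ (1 / 3 : ℝ)) *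
        Real.log n ^ 3 ∧
      ∀ σ, IsAdmissible f σ → ENNReal.ofReal (1 - 1 / (n : ℝ) ^ 100) ≤
        (A.outputLaw σ).toOuterMeasure
          {H | IsSpanner (30000 * (Real.log n * Real.log (Real.log n))) (streamGraph σ) H} := by
  have hn0 : 0 < n := by omega
  have hn1 : (1 : ℝ) ≤ n := by exact_mod_cast hn0
  have hf2 : f ≤ n * n := by
    refine hf.trans ?_
    rw [Nat.choose_two_right]
    exact (Nat.div_le_self _ _).trans (Nat.mul_le_mul_left _ (Nat.sub_le _ _))
  set g : ℝ := max (f : ℝ) 1 with hg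
  have hg1 : 1 ≤ g := le_max_right _ _
  set y : ℝ := (n * g) ^ (1 / 3 : ℝ) with hy
  have hy3 : y ^ 3 = n * g := by
    rw [hy, ← Real.rpow_natCast, ← Real.rpow_mul (by positivity)]
    norm_num
  have hy1 : 1 ≤ y := Real.one_le_rpow (by nlinarith) (by norm_num)
  have hsc1 : (1 : ℝ) ≤ scale n := by exact_mod_cast one_le_scale n
  have hbound : ∀ s : ℝ, s ≤ 900000 * ((scale n : ℝ) ^ 3 * (n * y)) →
      s ≤ 24300000 * ((n : ℝ) ^ (4 / 3 : ℝ) * g ^ (1 / 3 : ℝ)) * Real.log n ^ 3 := by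
    intro s hs
    rw [rpow_mul_rpow_eq hn0 (by linarith), ← hy]
    refine hs.trans ?_
    have h1 : (scale n : ℝ) ^ 3 ≤ (3 * Real.log n) ^ 3 :=
      pow_le_pow_left₀ (by positivity) (scale_le hn) 3
    calc 900000 * ((scale n : ℝ) ^ 3 * (n * y)) ≤ 900000 * ((3 * Real.log n) ^ 3 * (n * y)) := by
          gcongr
      _ = _ := by ring
  by_cases hnf : n ≤ f * f
  · have hfpos : 0 < f := by
      rcases Nat.eq_zero_or_pos f with rfl | h
      · omega
      · exact h
    have hgf : g = f := max_eq_left (by exact_mod_cast hfpos)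
    have hm : 1 < n * f := by nlinarith
    obtain ⟨i₀, h1, h2, h3⟩ := exists_level hm (by linarith : (0 : ℝ) ≤ y)
      (by rw [hy3, hgf]; push_cast; rfl)
    have hi₀ : f ≤ 2 ^ i₀ * 2 ^ i₀ := by
      refine le_of_pow_le_pow_left₀ (n := 3) (by norm_num) (Nat.zero_le _) ?_
      calc f ^ 3 = f * (f * f) := by ring
        _ ≤ n * n * (f * f) := Nat.mul_le_mul_right _ hf2
        _ = (n * f) * (n * f) := by ring
        _ ≤ (2 ^ i₀) ^ 3 * (2 ^ i₀) ^ 3 := Nat.mul_le_mul h1 h1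
        _ = (2 ^ i₀ * 2 ^ i₀) ^ 3 := by ring
    obtain ⟨A, hA⟩ := exists_algorithm_many_deletions hn hf2 hi₀
    exact ⟨_, A, hbound _ (manySpace_le hn0 hy1 (by rw [hy3, hgf]) hf2 hnf h2 h3), hA⟩
  · obtain ⟨A, hA⟩ := exists_algorithm_few_deletions hn f
    refine ⟨_, A, hbound _ ?_, hA⟩
    have hgy : g ≤ y := by
      refine le_of_pow_le_pow_left₀ (n := 3) (by norm_num) (by linarith) ?_
      rw [hy3]
      have h1 : g * g ≤ n := by
        rcases le_total (f : ℝ) 1 with h | h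
        · rw [hg, max_eq_right h]
          linarith
        · rw [hg, max_eq_left h]
          exact_mod_cast (not_le.1 hnf).le
      nlinarith
    have hfg : (f : ℝ) ≤ g := le_max_left _ _
    have h2 : (scale n : ℝ) ^ 2 ≤ scale n ^ 3 := pow_le_pow_right₀ hsc1 (by norm_num)
    push_cast
    calc 2 * (scale n : ℝ) * (16 * (f + 1) * n * (2 * scale n))
        = 64 * ((scale n : ℝ) ^ 2 * (n * (f + 1))) := by ring
      _ ≤ 64 * ((scale n : ℝ) ^ 3 * (n * (2 * y))) := by
        gcongr
        linarith
      _ = 128 * ((scale n : ℝ) ^ 3 * (n * y)) := by ring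
      _ ≤ 900000 * ((scale n : ℝ) ^ 3 * (n * y)) := by
        gcongr
        norm_num

end Space

end DynamicSpanner

theorem theorem7p2 :
    ∃ (C₁ C₂ : ℝ) (k : ℕ) (space : ℕ → ℕ → ℕ)
      (A : ∀ n f : ℕ, StreamingAlgorithm n (space n f)),
      0 < C₁ ∧ 0 < C₂ ∧
      ∀ n f : ℕ, 3 ≤ n → f ≤ n.choose 2 →
        (space n f : ℝ) ≤
            C₁ * ((n : ℝ) ^ (4 / 3 : ℝ) * (max (f : ℝ) 1) ^ (1 / 3 : ℝ)) * Real.log n ^ k ∧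
        ∀ σ : List (EdgeUpdate n), IsValidStream σ → numDeletions σ ≤ f →
          ENNReal.ofReal (1 - 1 / (n : ℝ) ^ 100) ≤
            ((A n f).outputLaw σ).toOuterMeasure
              {H | IsSpanner (C₂ * (Real.log n * Real.log (Real.log n))) (streamGraph σ) H} := by
  classical
  have key : ∀ n f : ℕ, ∃ (s : ℕ) (A : StreamingAlgorithm n s), 3 ≤ n → f ≤ n.choose 2 →
      (s : ℝ) ≤ 24300000 * ((n : ℝ) ^ (4 / 3 : ℝ) * (max (f : ℝ) 1) ^ (1 / 3 : ℝ)) *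
        Real.log n ^ 3 ∧
      ∀ σ, DynamicSpanner.IsAdmissible f σ → ENNReal.ofReal (1 - 1 / (n : ℝ) ^ 100) ≤
        (A.outputLaw σ).toOuterMeasure
          {H | IsSpanner (30000 * (Real.log n * Real.log (Real.log n))) (streamGraph σ) H} := by
    intro n f
    by_cases h : 3 ≤ n ∧ f ≤ n.choose 2
    · obtain ⟨s, A, h1, h2⟩ := DynamicSpanner.exists_algorithm h.1 h.2
      exact ⟨s, A, fun _ _ => ⟨h1, h2⟩⟩
    -- for other `n` and `f` nothing is claimed, and any algorithm will do
    · exact ⟨0, ⟨PMF.pure default, fun m _ => PMF.pure m, fun _ => ⊥⟩,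
        fun h1 h2 => absurd ⟨h1, h2⟩ h⟩
  choose space A hA using key
  exact ⟨24300000, 30000, 3, space, A, by norm_num, by norm_num, fun n f hn hf =>
    ⟨(hA n f hn hf).1, fun σ h1 h2 => (hA n f hn hf).2 σ ⟨h1, h2⟩⟩⟩
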